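/- Let $K$ be a field of characteristic $0$. Graded vector spaces are $\mathbb Z$-graded over $K$ and come with a homogeneous basis. **$\mathcal Eilh$-algebras.** These are graded vector spaces with bilinear products $\oslash_i$, $i\in\mathbb N=\{0,1,\dots\}$, with $|a\oslash_i b|=|a|+|b|+i$, such that for homogeneous $a,b,c$ $$a\oslash_i(b\oslash_i c)=(-1)^{i(|a|+1)}\big((a\oslash_i b)\oslash_i c+(-1)^{i+|a||b|}(b\oslash_i a)\oslash_i c\big),$$ and, for all $j>i$, $\;a\oslash_i(b\oslash_j c)=(-1)^{ij+j|a|}(a\oslash_i b)\oslash_j c$ and $$a\oslash_j(b\oslash_i c)=(-1)^{i|a|+|a||b|}(b\oslash_i a)\oslash_j c+[j-i\ge 2]\,(-1)^{i(|a|+j+1)+(|a|+|b|)|c|}(c\oslash_{j-1}a)\oslash_{i+1}b+[j-i\ge 3]\,(-1)^{j+|a|(|b|+i)+(|a|+|b|)|c|}(c\oslash_{i+1}b)\oslash_{j-1}a,$$ where $[P]$ is $1$ if $P$ holds and $0$ otherwise. **Chevalley–Eilenberg algebras.** For a graded vector space $V$ let $\bigodot V$ be the reduced (non-unital) graded symmetric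 algebra and $\mathcal E(V)$ the reduced free $\mathcal Eilh$-algebra on $V$. Both are graded by the order in $V$, and we allow formal sums $\sum_{n\ge1}x_n$ with $x_n$ of order $n$. Differentials and morphisms below are linear maps on such formal sums that preserve the filtration by order (so everything is uncurved). An $L_\infty$-algebra $\mathfrak L$, with $V=\mathfrak L[1]^*$, is a degree-$1$ derivation $Q$ of $\bigodot V$ with $Q^2=0$. An $EL_\infty$-algebra $\mathfrak E$, with $V=\mathfrak E[1]^*$, is a degree-$1$ map $Q$ on $\mathcal E(V)$ with $Q^2=0$ and $$Q(a\oslash_i b)=(-1)^i\big((Qa)\oslash_i b+(-1)^{|a|}a\oslash_i Qb\big)+(-1)^i\,a\oslash_{i+1}b-(-1)^{|a||b|}\,b\oslash_{i+1}a .$$ A morphism $\phi$ from one such algebra to another, of the same kind, with Chevalley–Eilenberg differentials $Q$ (source) and $\tilde Q$ (target), on the algebras generated by $V$ and $\tilde V$, is given by its dual: a degree-$0$ map $\Phi$ from the algebra generated by $\tilde V$ to the algebra generated by $V$ that preserves all products and satisfies $Q\circ\Phi=\Phi\circ\tilde Q$. **The embedding.** Let $\mathsf E:\bigodot V\to\mathcal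 E(V)$ be the linear map $$\mathsf E(v_1\odot\dots\odot v_n)=\sum_{\sigma\in S_n}\pm\,(\cdots(v_{\sigma(1)}\oslash_0 v_{\sigma(2)})\oslash_0\cdots)\oslash_0 v_{\sigma(n)},$$ where $\pm$ is the Koszul sign of the permutation, extended termwise to formal sums. **Theorem.** (a) Every $L_\infty$-algebra $\mathfrak L=(\bigodot V,Q)$ can be regarded as an $EL_\infty$-algebra $\hat{\mathfrak L}$: there is exactly one $EL_\infty$-differential $\hat Q$ on $\mathcal E(V)$ with $\hat Q(v)=\mathsf E(Qv)$ for all $v\in V$. (b) Let $\phi:\mathfrak L\to\tilde{\mathfrak L}$ be a morphism of $L_\infty$-algebras with dual $\Phi:\bigodot\tilde V\to\bigodot V$. Then $\phi$ lifts to a morphism of $EL_\infty$-algebras $\hat\phi:\hat{\mathfrak L}\to\hat{\tilde{\mathfrak L}}$: there is exactly one such morphism whose dual $\hat\Phi:\mathcal E(\tilde V)\to\mathcal E(V)$ satisfies $\hat\Phi(v)=\mathsf E(\Phi(v))$ for all $v\in\tilde V$. Moreover, $\hat\Phi\circ\mathsf E=\mathsf E\circ\Phi$. (c) If $Q$ (respectively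 $\tilde Q$, $\Phi$) maps the generating vector space $V$ (respectively $\tilde V$, $\tilde V$) to finite sums, then $\hat Q$ (respectively $\hat{\tilde Q}$, $\hat\Phi$) maps finite sums to finite sums. -/

import Mathlib

namespace ELInfinity

/-! ### Signs and free algebras with several binary products -/

/-- The sign `(-1)^n`, as an element of the ground field. -/
def sgn (K : Type*) [Field K] (n : ℤ) : K := ((n.negOnePow : ℤ) : K)

/-- Fully bracketed monomials in generators `A`, with binary operation symbols indexed by `I`. -/
inductive Mono (I A : Type*) where
  | gen (a : A) : Mono I A
  | op (i : I) (s t : Mono I A) : Mono I A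

namespace Mono

variable {I A : Type*}

/-- Degree of a monomial: `d` is the degree of the generators, `ω i` that of the operation `i`. -/
def deg (ω : I → ℤ) (d : A → ℤ) : Mono I A → ℤ
  | gen a => d a
  | op i s t => s.deg ω d + t.deg ω d + ω i

/-- The number of generators in a monomial (its order in the generating vector space). -/
def len : Mono I A → ℕ
  | gen _ => 1
  | op _ s t => s.len + t.len

/-- The generators of a monomial, from left to right. -/
def word : Mono I A → List A
  | gen a => [a]
  | op _ s t => s.word ++ t.word

end Mono

/-- The free vector space with bilinear operations indexed by `I`, on generators `A`. -/
abbrev NonAssoc (K I A : Type*) [Field K] := Mono I A →₀ K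

section Free

variable (K : Type*) [Field K] {I A : Type*}

/-- A monomial, as a basis vector of the free non-associative algebra. -/
noncomputable def mono (t : Mono I A) : NonAssoc K I A := Finsupp.single t 1

variable {K}

/-- The bilinear product with `mono s * mono t = mono (op i s t)`. -/
noncomputable def NonAssoc.mul (i : I) :
    NonAssoc K I A →ₗ[K] NonAssoc K I A →ₗ[K] NonAssoc K I A :=
  Finsupp.linearCombination K fun s => Finsupp.lmapDomain K K (Mono.op i s)

theorem NonAssoc.mul_mono (i : I) (s t : Mono I A) :
    NonAssoc.mul i (mono K s) (mono K t) = mono K (Mono.op i s t) := by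
  simp [NonAssoc.mul, mono]

/-- The ideal (for all the products) generated by a set of relations. -/
noncomputable def ideal (R : Set (NonAssoc K I A)) : Submodule K (NonAssoc K I A) :=
  sInf {J | R ⊆ J ∧ ∀ i x y, (x ∈ J ∨ y ∈ J) → NonAssoc.mul i x y ∈ J}

theorem mul_mem_ideal (R : Set (NonAssoc K I A)) (i : I) (x y : NonAssoc K I A)
    (h : x ∈ ideal R ∨ y ∈ ideal R) : NonAssoc.mul i x y ∈ ideal R := by
  simp only [ideal, Submodule.mem_sInf] at h ⊢
  intro J hJ
  exact hJ.2 i x y (h.imp (fun h => h J hJ) (fun h => h J hJ))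

/-- The algebra presented by the generators `A` and the relations `R`. -/
abbrev Alg (R : Set (NonAssoc K I A)) := NonAssoc K I A ⧸ ideal R

/-- The class of a monomial. -/
noncomputable def cls (R : Set (NonAssoc K I A)) (t : Mono I A) : Alg R :=
  (ideal R).mkQ (mono K t)

/-- The bilinear products of the presented algebra. -/
noncomputable def prod (R : Set (NonAssoc K I A)) (i : I) : Alg R →ₗ[K] Alg R →ₗ[K] Alg R :=
  (ideal R).liftQ
    ((Submodule.mapQLinear (ideal R) (ideal R)).comp
      ((NonAssoc.mul (K := K) (A := A) i).codRestrict
        (Submodule.compatibleMaps (ideal R) (ideal R))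
        fun x _ hy => mul_mem_ideal R i x _ (Or.inr hy)))
    (by
      intro x hx
      rw [LinearMap.mem_ker]
      apply LinearMap.ext
      intro y
      obtain ⟨y, rfl⟩ := (ideal R).mkQ_surjective y
      exact (Submodule.Quotient.mk_eq_zero _).2 (mul_mem_ideal R i x y (Or.inl hx)))

theorem prod_mkQ (R : Set (NonAssoc K I A)) (i : I) (x y : NonAssoc K I A) :
    prod R i ((ideal R).mkQ x) ((ideal R).mkQ y) = (ideal R).mkQ (NonAssoc.mul i x y) := rfl

theorem prod_cls (R : Set (NonAssoc K I A)) (i : I) (s t : Mono I A) :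
    prod R i (cls R s) (cls R t) = cls R (Mono.op i s t) := by
  rw [cls, cls, prod_mkQ, NonAssoc.mul_mono, cls]

/-- The part of order `n` in the generators. -/
noncomputable def weight (R : Set (NonAssoc K I A)) (n : ℕ) : Submodule K (Alg R) :=
  Submodule.span K {x | ∃ t : Mono I A, t.len = n ∧ x = cls R t}

/-- The part of degree `p`. -/
noncomputable def homog (R : Set (NonAssoc K I A)) (ω : I → ℤ) (d : A → ℤ) (p : ℤ) : Submodule K (Alg R) :=
  Submodule.span K {x | ∃ t : Mono I A, t.deg ω d = p ∧ x = cls R t}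

theorem prod_mem_weight (R : Set (NonAssoc K I A)) (i : I) {m n : ℕ} {x y : Alg R}
    (hx : x ∈ weight R m) (hy : y ∈ weight R n) : prod R i x y ∈ weight R (m + n) := by
  induction hx using Submodule.span_induction with
  | zero => simp
  | add x x' _ _ h h' => simpa using add_mem h h'
  | smul c x _ h => simpa using Submodule.smul_mem _ c h
  | mem x hx =>
    obtain ⟨s, rfl, rfl⟩ := hx
    induction hy using Submodule.span_induction with
    | zero => simp
    | add x x' _ _ h h' => simpa using add_mem h h'
    | smul c x _ h => simpa using Submodule.smul_mem _ c h
    | mem y hy =>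
      obtain ⟨t, rfl, rfl⟩ := hy
      exact Submodule.subset_span ⟨Mono.op i s t, rfl, prod_cls R i s t⟩

/-! ### Formal sums over the order in the generators -/

/-- Formal sums `∑ₙ xₙ` with `xₙ` of order `n` in the generators, i.e. the product over `n`
of the parts of order `n`. The finite sums among them form the presented algebra itself. -/
abbrev Formal (R : Set (NonAssoc K I A)) := ↥(Submodule.pi Set.univ (weight R))

namespace Formal

variable {R : Set (NonAssoc K I A)}

/-- The component of order `n`. -/
def coeff (n : ℕ) (x : Formal R) : Alg R := x.1 n

/-- The product of formal sums. -/
noncomputable def mul (i : I) (x y : Formal R) : Formal R :=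
  ⟨fun n => ∑ k ∈ Finset.HasAntidiagonal.antidiagonal n, prod R i (coeff k.1 x) (coeff k.2 y), by
    intro n _
    refine Submodule.sum_mem _ fun k hk => ?_
    rw [Finset.HasAntidiagonal.mem_antidiagonal] at hk
    exact hk ▸ prod_mem_weight R i (x.2 k.1 trivial) (y.2 k.2 trivial)⟩

/-- Homogeneity of degree `p`. -/
def IsHomog (ω : I → ℤ) (d : A → ℤ) (p : ℤ) (x : Formal R) : Prop :=
  ∀ n, coeff n x ∈ homog R ω d p

/-- All the terms of `x` have order at least `n`. -/
def OrderGE (n : ℕ) (x : Formal R) : Prop := ∀ m < n, coeff m x = 0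

/-- `x` is a finite sum, i.e. an element of the uncompleted algebra. -/
def IsFinite (x : Formal R) : Prop := ∃ N, ∀ n ≥ N, coeff n x = 0

/-- The inclusion of the generating vector space `V`, with basis `A`. -/
noncomputable def incl (R : Set (NonAssoc K I A)) : (A →₀ K) →ₗ[K] Formal R :=
  Finsupp.linearCombination K fun a =>
    ⟨Pi.single 1 (cls R (Mono.gen a)), by
      intro n _
      by_cases h : n = 1
      · subst h
        rw [Pi.single_eq_same]
        exact Submodule.subset_span (Exists.intro (Mono.gen a) (And.intro rfl rfl))
      · simp [Pi.single_eq_of_ne h]⟩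

end Formal

end Free

/-! ### Semifree graded commutative algebras and semifree `Eilh`-algebras

Throughout, `d : A → ℤ` gives the degrees of a homogeneous basis `A` of a graded vector space `V`.
For an algebra with underlying graded vector space `E`, this is `V = E[1]^*`. -/

section Semifree

variable (K : Type*) [Field K] {A : Type*}

/-- The degree of the product `⊘ᵢ` is `i`. -/
def eilhDeg (i : ℕ) : ℤ := i

/-- The graded commutative product has degree `0`. -/
def symDeg (_ : Unit) : ℤ := 0

/-- The relations of the reduced graded symmetric algebra: associativity and
graded commutativity. -/
inductive SymRel (d : A → ℤ) : NonAssoc K Unit A → Prop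
  | assoc (a b c : Mono Unit A) :
      SymRel d (mono K (.op () (.op () a b) c) - mono K (.op () a (.op () b c)))
  | comm (a b : Mono Unit A) :
      SymRel d (mono K (.op () a b)
        - sgn K (a.deg symDeg d * b.deg symDeg d) • mono K (.op () b a))

/-- The quadratic relations of `Eilh`-algebras, on monomials `a`, `b`, `c`; the general case
follows by linearity. -/
inductive EilhRel (d : A → ℤ) : NonAssoc K ℕ A → Prop
  | eq (i : ℕ) (a b c : Mono ℕ A) :
      EilhRel d (mono K (.op i a (.op i b c))
        - sgn K (i * (a.deg eilhDeg d + 1)) •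
          (mono K (.op i (.op i a b) c)
            + sgn K (i + a.deg eilhDeg d * b.deg eilhDeg d) • mono K (.op i (.op i b a) c)))
  | lt (i j : ℕ) (h : i < j) (a b c : Mono ℕ A) :
      EilhRel d (mono K (.op i a (.op j b c))
        - sgn K (i * j + j * a.deg eilhDeg d) • mono K (.op j (.op i a b) c))
  | gt_one (i j : ℕ) (h : j = i + 1) (a b c : Mono ℕ A) :
      EilhRel d (mono K (.op j a (.op i b c))
        - sgn K (i * a.deg eilhDeg d + a.deg eilhDeg d * b.deg eilhDeg d) •
            mono K (.op j (.op i b a) c))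
  | gt_two (i j : ℕ) (h : j = i + 2) (a b c : Mono ℕ A) :
      EilhRel d (mono K (.op j a (.op i b c))
        - (sgn K (i * a.deg eilhDeg d + a.deg eilhDeg d * b.deg eilhDeg d) •
              mono K (.op j (.op i b a) c)
          + sgn K (i * (a.deg eilhDeg d + j + 1)
              + (a.deg eilhDeg d + b.deg eilhDeg d) * c.deg eilhDeg d) •
              mono K (.op (i + 1) (.op (j - 1) c a) b)))
  | gt (i j : ℕ) (h : i + 2 < j) (a b c : Mono ℕ A) :
      EilhRel d (mono K (.op j a (.op i b c))
        - (sgn K (i * a.deg eilhDeg d + a.deg eilhDeg d * b.deg eilhDeg d) •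
              mono K (.op j (.op i b a) c)
          + sgn K (i * (a.deg eilhDeg d + j + 1)
              + (a.deg eilhDeg d + b.deg eilhDeg d) * c.deg eilhDeg d) •
              mono K (.op (i + 1) (.op (j - 1) c a) b)
          + sgn K (j + a.deg eilhDeg d * (b.deg eilhDeg d + i)
              + (a.deg eilhDeg d + b.deg eilhDeg d) * c.deg eilhDeg d) •
              mono K (.op (j - 1) (.op (i + 1) c b) a)))

/-- The reduced graded symmetric algebra on `V`. -/
abbrev Sym (d : A → ℤ) := Alg {x | SymRel K d x}

/-- The reduced free `Eilh`-algebra on `V`. -/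
abbrev Eilh (d : A → ℤ) := Alg {x | EilhRel K d x}

/-- The reduced graded symmetric algebra on `V`, completed with respect to the order in `V`. -/
abbrev SymHat (d : A → ℤ) := Formal {x | SymRel K d x}

/-- The reduced free `Eilh`-algebra on `V`, completed with respect to the order in `V`. -/
abbrev EilhHat (d : A → ℤ) := Formal {x | EilhRel K d x}

end Semifree

/-! ### The embedding of the symmetric algebra -/

section Embedding

variable {K : Type*} [Field K] {A : Type*}

/-- The Koszul sign of the reordering `v 0 ⊙ ⋯ ⊙ v (n-1) = ± v (σ 0) ⊙ ⋯ ⊙ v (σ (n-1))`. -/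
def koszul (K : Type*) [Field K] (d : A → ℤ) {n : ℕ} (v : Fin n → A)
    (σ : Equiv.Perm (Fin n)) : K :=
  ∏ x : Fin n × Fin n,
    if x.1 < x.2 ∧ σ x.2 < σ x.1 then sgn K (d (v (σ x.1)) * d (v (σ x.2))) else 1

/-- The left-nested product `(⋯(v₁ ⊘₀ v₂) ⊘₀ ⋯) ⊘₀ vₙ`; the empty word does not occur. -/
noncomputable def nest (K : Type*) [Field K] (d : A → ℤ) : List A → Eilh K d
  | [] => 0
  | a :: l => cls _ (l.foldl (fun t b => Mono.op 0 t (Mono.gen b)) (Mono.gen a))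

/-- `∑ σ, ± (⋯(v (σ 0) ⊘₀ v (σ 1)) ⊘₀ ⋯) ⊘₀ v (σ (n-1))`, with the Koszul sign. -/
noncomputable def symmetrize (K : Type*) [Field K] (d : A → ℤ) {n : ℕ} (v : Fin n → A) :
    Eilh K d :=
  ∑ σ : Equiv.Perm (Fin n), koszul K d v σ • nest K d (List.ofFn (v ∘ σ))

theorem sgn_mul_self (n : ℤ) : sgn K n * sgn K n = 1 := by
  have h : (n.negOnePow : ℤ) * (n.negOnePow : ℤ) = 1 := by
    rw [← Units.val_mul, ← Int.negOnePow_add, Int.negOnePow_even _ ⟨n, rfl⟩]; rfl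
  rw [sgn, ← Int.cast_mul, h, Int.cast_one]

theorem sgn_add (m n : ℤ) : sgn K (m + n) = sgn K m * sgn K n := by
  simp [sgn, Int.negOnePow_add]

theorem sgn_zero : sgn K 0 = 1 := by simp [sgn]

theorem prod_pairs {n : ℕ} (H : Fin n × Fin n → K) (hH : ∀ p, H (p, p) = 1) :
    ∏ x, H x = ∏ x : Fin n × Fin n, if x.1 < x.2 then H x * H x.swap else 1 := by
  have h1 : ∀ x : Fin n × Fin n, (if x.1 < x.2 then H x * H x.swap else 1)
      = (if x.1 < x.2 then H x else 1) * (if x.1 < x.2 then H x.swap else 1) := by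
    intro x; split_ifs <;> simp
  have h2 : ∏ x : Fin n × Fin n, (if x.1 < x.2 then H x.swap else 1)
      = ∏ x : Fin n × Fin n, (if x.2 < x.1 then H x else 1) :=
    Fintype.prod_equiv (Equiv.prodComm _ _) _ _ fun x => rfl
  rw [Finset.prod_congr rfl fun x _ => h1 x, Finset.prod_mul_distrib, h2,
    ← Finset.prod_mul_distrib]
  refine Finset.prod_congr rfl fun x _ => ?_
  obtain ⟨p, q⟩ := x
  rcases lt_trichotomy p q with h | h | h
  · simp [h, h.not_gt]
  · subst h; simp [hH]
  · simp [h, h.not_gt]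

theorem koszul_mul (d : A → ℤ) {n : ℕ} (v : Fin n → A) (τ σ : Equiv.Perm (Fin n)) :
    koszul K d v (τ * σ) = koszul K d v τ * koszul K d (v ∘ τ) σ := by
  have h : koszul K d v τ = ∏ x : Fin n × Fin n, if σ x.1 < σ x.2 ∧ τ (σ x.2) < τ (σ x.1) then
      sgn K (d (v (τ (σ x.1))) * d (v (τ (σ x.2)))) else 1 :=
    (Fintype.prod_equiv (Equiv.prodCongr σ σ) _ _ fun x => rfl).symm
  rw [h, prod_pairs _ (by simp), koszul, koszul, ← Finset.prod_mul_distrib]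
  refine Finset.prod_congr rfl fun x _ => ?_
  obtain ⟨p, q⟩ := x
  by_cases hpq : p < q
  · have hne : σ p ≠ σ q := fun h => hpq.ne (σ.injective h)
    have hne' : τ (σ p) ≠ τ (σ q) := fun h => hne (τ.injective h)
    have hc : d (v (τ (σ q))) * d (v (τ (σ p))) = d (v (τ (σ p))) * d (v (τ (σ q))) :=
      mul_comm _ _
    rcases lt_or_gt_of_ne hne with h1 | h1 <;> rcases lt_or_gt_of_ne hne' with h2 | h2 <;>
      simp [hpq, h1, h2, h1.not_gt, h2.not_gt, hc, sgn_mul_self]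
  · simp [hpq]

theorem koszul_mul_self (d : A → ℤ) {n : ℕ} (v : Fin n → A) (σ : Equiv.Perm (Fin n)) :
    koszul K d v σ * koszul K d v σ = 1 := by
  rw [koszul, ← Finset.prod_mul_distrib]
  refine Finset.prod_eq_one fun x _ => ?_
  split_ifs <;> simp [sgn_mul_self]

theorem symmetrize_comp (d : A → ℤ) {n : ℕ} (v : Fin n → A) (τ : Equiv.Perm (Fin n)) :
    symmetrize K d (v ∘ τ) = koszul K d v τ • symmetrize K d v := by
  rw [symmetrize, symmetrize, Finset.smul_sum]
  refine Fintype.sum_equiv (Equiv.mulLeft τ) _ _ fun σ => ?_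
  rw [Equiv.coe_mulLeft, koszul_mul, smul_smul, ← mul_assoc, koszul_mul_self, one_mul]
  rfl

/-- Two neighbouring letters give the expected Koszul sign. -/
theorem koszul_swap (d : A → ℤ) {n : ℕ} (v : Fin n → A) (i j : Fin n)
    (hij : (j : ℕ) = i + 1) : koszul K d v (Equiv.swap i j) = sgn K (d (v i) * d (v j)) := by
  have hlt : i < j := by rw [Fin.lt_def]; omega
  rw [koszul, Finset.prod_eq_single (i, j)]
  · simp [hlt, mul_comm]
  · rintro ⟨p, q⟩ - hne
    rw [if_neg]
    rintro ⟨h1, h2⟩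
    apply hne
    simp only [Equiv.swap_apply_def] at h2
    simp only [Prod.mk.injEq, Fin.ext_iff]
    simp only [Fin.lt_def] at h1
    split_ifs at h2 <;> simp only [Fin.lt_def, Fin.ext_iff] at * <;> omega
  · simp

/-- `symmetrize` for a word. -/
noncomputable def symWord (K : Type*) [Field K] (d : A → ℤ) (l : List A) : Eilh K d :=
  symmetrize K d l.get

theorem symWord_ofFn (d : A → ℤ) {n : ℕ} (v : Fin n → A) :
    symWord K d (List.ofFn v) = symmetrize K d v := by
  have : ∀ (m : ℕ) (h : m = n) (w : Fin m → A), (∀ i, w i = v (Fin.cast h i)) →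
      symmetrize K d w = symmetrize K d v := by
    rintro m rfl w hw
    congr 1
    funext i
    exact hw i
  exact this _ (List.length_ofFn) _ fun i => by simp [Fin.cast]

theorem symWord_swap (d : A → ℤ) (u w : List A) (a b : A) :
    symWord K d (u ++ a :: b :: w) = sgn K (d a * d b) • symWord K d (u ++ b :: a :: w) := by
  set l := u ++ b :: a :: w with hl
  have hlen : l.length = u.length + (w.length + 2) := by simp [hl]
  let i : Fin l.length := ⟨u.length, by omega⟩
  let j : Fin l.length := ⟨u.length + 1, by omega⟩
  have hi : l.get i = b := by simp [hl, i]
  have hj : l.get j = a := by simp [hl, j]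
  have hk := koszul_swap (K := K) d l.get i j rfl
  have hw : List.ofFn (l.get ∘ Equiv.swap i j) = u ++ a :: b :: w := by
    apply List.ext_getElem
    · simp [hl]; omega
    · intro k h1 h2
      rw [List.getElem_ofFn]
      have h3 : k < l.length := by simpa using h1
      by_cases hki : k = u.length
      · subst hki
        have : (⟨u.length, h3⟩ : Fin l.length) = i := rfl
        rw [Function.comp_apply, this, Equiv.swap_apply_left, hj]
        simp
      · by_cases hkj : k = u.length + 1
        · subst hkj
          have : (⟨u.length + 1, h3⟩ : Fin l.length) = j := rfl
          rw [Function.comp_apply, this, Equiv.swap_apply_right, hi]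
          simp
        · have hne1 : (⟨k, h3⟩ : Fin l.length) ≠ i := by simpa [i, Fin.ext_iff] using hki
          have hne2 : (⟨k, h3⟩ : Fin l.length) ≠ j := by simpa [j, Fin.ext_iff] using hkj
          rw [Function.comp_apply, Equiv.swap_apply_of_ne_of_ne hne1 hne2]
          simp only [hl, List.get_eq_getElem]
          rcases lt_or_ge k u.length with h | h
          · rw [List.getElem_append_left h, List.getElem_append_left h]
          · rw [List.getElem_append_right h, List.getElem_append_right h]
            obtain ⟨m, hm⟩ : ∃ m, k - u.length = m + 2 := ⟨k - u.length - 2, by omega⟩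
            simp [hm]
  rw [← hw, symWord_ofFn, symmetrize_comp, hk, hi, hj, mul_comm (d b), symWord]

/-- The degree of a word. -/
def wordDeg (d : A → ℤ) (l : List A) : ℤ := (l.map d).sum

theorem symWord_move (d : A → ℤ) (u y w : List A) (a : A) :
    symWord K d (u ++ a :: (y ++ w))
      = sgn K (d a * wordDeg d y) • symWord K d (u ++ y ++ a :: w) := by
  induction y generalizing u with
  | nil => simp [wordDeg, sgn_zero]
  | cons b y ih =>
    have h := ih (u ++ [b])
    simp only [List.append_assoc, List.cons_append, List.nil_append] at h
    rw [List.cons_append, symWord_swap, h, smul_smul, ← sgn_add]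
    simp [wordDeg, mul_add]

theorem symWord_block (d : A → ℤ) (u x y w : List A) :
    symWord K d (u ++ x ++ y ++ w)
      = sgn K (wordDeg d x * wordDeg d y) • symWord K d (u ++ y ++ x ++ w) := by
  induction x generalizing u w with
  | nil => simp [wordDeg, sgn_zero]
  | cons a x ih =>
    have h := ih (u ++ [a]) w
    have h' := symWord_move (K := K) d u y (x ++ w) a
    simp only [List.append_assoc, List.cons_append, List.nil_append] at h h' ⊢
    rw [h, h', smul_smul, ← sgn_add]
    simp [wordDeg, add_mul, add_comm]

theorem wordDeg_word (d : A → ℤ) (t : Mono Unit A) : wordDeg d t.word = t.deg symDeg d := by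
  induction t with
  | gen a => simp [wordDeg, Mono.word, Mono.deg]
  | op i s t hs ht => simp_all [wordDeg, Mono.word, Mono.deg, symDeg]

/-- `v₁ ⊙ ⋯ ⊙ vₙ ↦ ∑ σ, ± (⋯(v (σ 1) ⊘₀ v (σ 2)) ⊘₀ ⋯) ⊘₀ v (σ n)` on bracketed monomials. -/
noncomputable def embPre (K : Type*) [Field K] (d : A → ℤ) : NonAssoc K Unit A →ₗ[K] Eilh K d :=
  Finsupp.linearCombination K fun t => symWord K d t.word

theorem embPre_ideal (d : A → ℤ) : ideal {x | SymRel K d x} ≤ LinearMap.ker (embPre K d) := by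
  let F : List A → List A → NonAssoc K Unit A →ₗ[K] Eilh K d := fun u w =>
    Finsupp.linearCombination K fun t => symWord K d (u ++ t.word ++ w)
  have hF : ∀ u w t, F u w (mono K t) = symWord K d (u ++ t.word ++ w) := by
    intro u w t; simp [F, mono]
  have hleft : ∀ u w s, F u w ∘ₗ NonAssoc.mul () (mono K s) = F (u ++ s.word) w := by
    intro u w s
    refine Finsupp.lhom_ext' fun t => LinearMap.ext_ring ?_
    change F u w (NonAssoc.mul () (mono K s) (mono K t)) = F (u ++ s.word) w (mono K t)
    rw [NonAssoc.mul_mono, hF, hF]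
    simp [Mono.word]
  have hright : ∀ u w t, F u w ∘ₗ (NonAssoc.mul ()).flip (mono K t) = F u (t.word ++ w) := by
    intro u w t
    refine Finsupp.lhom_ext' fun s => LinearMap.ext_ring ?_
    change F u w (NonAssoc.mul () (mono K s) (mono K t)) = F u (t.word ++ w) (mono K s)
    rw [NonAssoc.mul_mono, hF, hF]
    simp [Mono.word]
  let J : Submodule K (NonAssoc K Unit A) := ⨅ u, ⨅ w, LinearMap.ker (F u w)
  have hJ : ∀ x, x ∈ J ↔ ∀ u w, F u w x = 0 := by
    intro x; simp [J, Submodule.mem_iInf]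
  have hle : ideal {x | SymRel K d x} ≤ J := by
    refine sInf_le ⟨?_, ?_⟩
    · rintro x hx
      rw [SetLike.mem_coe, hJ]
      intro u w
      rcases hx with ⟨a, b, c⟩ | ⟨a, b⟩
      · simp [hF, Mono.word]
      · have h := symWord_block (K := K) d u a.word b.word w
        rw [wordDeg_word, wordDeg_word] at h
        rw [map_sub, map_smul, hF, hF, sub_eq_zero]
        simpa [Mono.word] using h
    · rintro ⟨⟩ x y h
      rw [hJ]
      intro u w
      rcases h with h | h
      · rw [hJ] at h
        suffices F u w ∘ₗ NonAssoc.mul () x = 0 from LinearMap.congr_fun this y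
        refine Finsupp.lhom_ext' fun t => LinearMap.ext_ring ?_
        have := LinearMap.congr_fun (hright u w t) x
        rw [h] at this
        exact this
      · rw [hJ] at h
        suffices F u w ∘ₗ (NonAssoc.mul ()).flip y = 0 from LinearMap.congr_fun this x
        refine Finsupp.lhom_ext' fun s => LinearMap.ext_ring ?_
        have := LinearMap.congr_fun (hleft u w s) y
        rw [h] at this
        exact this
  intro x hx
  have h := (hJ x).1 (hle hx) [] []
  rw [LinearMap.mem_ker, ← h]
  simp [F, embPre]

/-- The embedding `E` of the symmetric algebra into the free `Eilh`-algebra. -/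
noncomputable def emb (K : Type*) [Field K] (d : A → ℤ) : Sym K d →ₗ[K] Eilh K d :=
  (ideal {x | SymRel K d x}).liftQ (embPre K d) (embPre_ideal d)

theorem emb_cls (d : A → ℤ) (t : Mono Unit A) : emb K d (cls _ t) = symWord K d t.word := by
  change embPre K d (mono K t) = _
  simp [embPre, mono]

theorem nest_mem_weight (d : A → ℤ) (l : List A) :
    nest K d l ∈ weight {x | EilhRel K d x} l.length := by
  cases l with
  | nil => exact Submodule.zero_mem _
  | cons a l =>
    have h : ∀ (l : List A) (t : Mono ℕ A),
        (l.foldl (fun t b => Mono.op 0 t (Mono.gen b)) t).len = t.len + l.length := by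
      intro l
      induction l with
      | nil => intro t; rfl
      | cons b l ih => intro t; rw [List.foldl_cons, ih]; simp [Mono.len]; omega
    refine Submodule.subset_span ⟨_, ?_, rfl⟩
    rw [h]; simp [Mono.len]; omega

theorem emb_mem_weight (d : A → ℤ) (n : ℕ) (x : Sym K d) (hx : x ∈ weight _ n) :
    emb K d x ∈ weight {x | EilhRel K d x} n := by
  induction hx using Submodule.span_induction with
  | zero => simp
  | add x x' _ _ h h' => simpa using add_mem h h'
  | smul c x _ h => simpa using Submodule.smul_mem _ c h
  | mem x hx =>
    obtain ⟨t, rfl, rfl⟩ := hx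
    have ht : t.word.length = t.len := by
      induction t with
      | gen a => rfl
      | op i s t hs ht => simp [Mono.word, Mono.len, hs, ht]
    rw [emb_cls]
    refine Submodule.sum_mem _ fun σ _ => Submodule.smul_mem _ _ ?_
    have := nest_mem_weight (K := K) d (List.ofFn (t.word.get ∘ σ))
    rw [List.length_ofFn] at this
    exact ht ▸ this

/-- The embedding `E`, on formal sums. -/
noncomputable def embHat (K : Type*) [Field K] (d : A → ℤ) : SymHat K d →ₗ[K] EilhHat K d where
  toFun x := ⟨fun n => emb K d (x.1 n), fun n _ => emb_mem_weight d n _ (x.2 n trivial)⟩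
  map_add' x y := by ext n; simp
  map_smul' c x := by ext n; simp

end Embedding

/-! ### `L_∞`-algebras, `EL_∞`-algebras and their morphisms

An algebra is given by its Chevalley--Eilenberg algebra on `V = E[1]^*`, which has a basis `A`
with degrees `d`. A differential maps the generators to formal sums over the order in `V`, whose
component of order `n` is dual to the products with `n` arguments. All algebras are uncurved: the
differentials and morphisms respect the filtration by the order in `V`. -/

section Structures

variable (K : Type*) [Field K] {A B : Type*}

/-- An `L_∞`-algebra: a differential on the graded symmetric algebra. -/
structure LInfty (d : A → ℤ) where
  /-- The Chevalley--Eilenberg differential. -/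
  Q : SymHat K d →ₗ[K] SymHat K d
  degree : ∀ p x, Formal.IsHomog symDeg d p x → Formal.IsHomog symDeg d (p + 1) (Q x)
  order : ∀ n x, Formal.OrderGE n x → Formal.OrderGE n (Q x)
  leibniz : ∀ p q x y, Formal.IsHomog symDeg d p x → Formal.IsHomog symDeg d q y →
    Q (Formal.mul () x y) = Formal.mul () (Q x) y + sgn K p • Formal.mul () x (Q y)
  square : ∀ x, Q (Q x) = 0

/-- An `EL_∞`-algebra: a differential on the free `Eilh`-algebra, satisfying the deformed
Leibniz rule. -/
structure ELInfty (d : A → ℤ) where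
  /-- The Chevalley--Eilenberg differential. -/
  Q : EilhHat K d →ₗ[K] EilhHat K d
  degree : ∀ p x, Formal.IsHomog eilhDeg d p x → Formal.IsHomog eilhDeg d (p + 1) (Q x)
  order : ∀ n x, Formal.OrderGE n x → Formal.OrderGE n (Q x)
  leibniz : ∀ (i : ℕ) p q x y, Formal.IsHomog eilhDeg d p x → Formal.IsHomog eilhDeg d q y →
    Q (Formal.mul i x y) =
      sgn K i • (Formal.mul i (Q x) y + sgn K p • Formal.mul i x (Q y))
      + sgn K i • Formal.mul (i + 1) x y - sgn K (p * q) • Formal.mul (i + 1) y x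
  square : ∀ x, Q (Q x) = 0

variable {K}

/-- A morphism of `L_∞`-algebras `φ : L → L'`, given by the dual morphism `Φ` of differential
graded commutative algebras from the Chevalley--Eilenberg algebra of `L'` to that of `L`. -/
structure LInfty.Hom {d : A → ℤ} {d' : B → ℤ} (L : LInfty K d) (L' : LInfty K d') where
  /-- The dual morphism. -/
  Φ : SymHat K d' →ₗ[K] SymHat K d
  degree : ∀ p x, Formal.IsHomog symDeg d' p x → Formal.IsHomog symDeg d p (Φ x)
  order : ∀ n x, Formal.OrderGE n x → Formal.OrderGE n (Φ x)
  mul : ∀ x y, Φ (Formal.mul () x y) = Formal.mul () (Φ x) (Φ y)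
  comm : ∀ x, L.Q (Φ x) = Φ (L'.Q x)

/-- A morphism of `EL_∞`-algebras `φ : E → E'`, given by the dual morphism `Φ` of
`Eilh`-algebras from the Chevalley--Eilenberg algebra of `E'` to that of `E`. -/
structure ELInfty.Hom {d : A → ℤ} {d' : B → ℤ} (E : ELInfty K d) (E' : ELInfty K d') where
  /-- The dual morphism. -/
  Φ : EilhHat K d' →ₗ[K] EilhHat K d
  degree : ∀ p x, Formal.IsHomog eilhDeg d' p x → Formal.IsHomog eilhDeg d p (Φ x)
  order : ∀ n x, Formal.OrderGE n x → Formal.OrderGE n (Φ x)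
  mul : ∀ (i : ℕ) x y, Φ (Formal.mul i x y) = Formal.mul i (Φ x) (Φ y)
  comm : ∀ x, E.Q (Φ x) = Φ (E'.Q x)

/-- `Lh` is the `L_∞`-algebra `L` regarded as an `EL_∞`-algebra: the Chevalley--Eilenberg
differential of `Lh` is `E ∘ Q` on the generating vector space `V`. -/
def LInfty.IsRegardedAs {d : A → ℤ} (L : LInfty K d) (Lh : ELInfty K d) : Prop :=
  ∀ v : A →₀ K, Lh.Q (Formal.incl _ v) = embHat K d (L.Q (Formal.incl _ v))

end Structures

end ELInfinity

/-! A map that respects the filtration by order is determined by its values on monomials, and the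
deformed Leibniz rule (or compatibility with products) computes these recursively from the
generators. Uniqueness (`ELInfty.ext_gen`, `ELInfty.Hom.ext_gen`) and preservation of finite sums
are inductions of this kind. The content is existence.

The recursion is well posed on bracketed monomials; one has to show that it kills the ideal of
`Eilh` relations. For any prescription of degree 1 on the generators this is the compatibility of
the rule with the quadratic relations (`leib_mul_mul_eq` and its companions). Terms with a
differentiated factor are matched by the same relation, and terms with a raised index by the
relations for neighbouring index pairs. Since the rule also makes the square vanish on a product as
soon as it vanishes on both factors, only generators remain to be checked for `Q² = 0`.

There the embedding `E` enters. The product `⊘₀` satisfies a graded Zinbiel identity, so its graded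
symmetrization is associative and commutative, and `E` turns `⊙` into this symmetrization
(`emb_prod`). In a symmetrized product the `⊘₁` deformation terms cancel in pairs, so the new
differential restricts to `Q` along `E` (`diff_embHat`); on a generator its square is `E(Q²v) = 0`.
Likewise the lift of `Φ` restricts to `Φ` along `E` (`hom_embHat`), which yields commutation with
the differentials on generators, and hence everywhere because both composites obey the same
recursion. -/

namespace ELInfinity

/-! ### Formal sums: products, filtration by order, extension from monomials by continuity. -/

section FormalSums

variable {K : Type*} [Field K] {I J A B : Type*}
  {R : Set (NonAssoc K I A)} {R' : Set (NonAssoc K J B)}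

theorem ideal_le {N : Submodule K (NonAssoc K I A)} (h : R ⊆ N)
    (hN : ∀ i x y, (x ∈ N ∨ y ∈ N) → NonAssoc.mul i x y ∈ N) : ideal R ≤ N :=
  sInf_le ⟨h, hN⟩

theorem subset_ideal (R : Set (NonAssoc K I A)) : R ⊆ ideal R := by
  intro x hx
  simp only [ideal, SetLike.mem_coe, Submodule.mem_sInf]
  exact fun N hN => hN.1 hx

/-- A linear map out of the free algebra is determined by the monomials. -/
theorem NonAssoc.hom_ext {M : Type*} [AddCommGroup M] [Module K M]
    {f g : NonAssoc K I A →ₗ[K] M} (h : ∀ t, f (mono K t) = g (mono K t)) : f = g :=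
  Finsupp.lhom_ext' fun t => LinearMap.ext_ring (h t)

/-- The linear map out of the free algebra with given values on the monomials. -/
noncomputable def onMono {M : Type*} [AddCommGroup M] [Module K M] (f : Mono I A → M) :
    NonAssoc K I A →ₗ[K] M :=
  Finsupp.linearCombination K f

@[simp] theorem onMono_mono {M : Type*} [AddCommGroup M] [Module K M] (f : Mono I A → M)
    (t : Mono I A) : onMono f (mono K t) = f t := by
  simp [onMono, mono]

theorem prod_mem_homog {ω : I → ℤ} {d : A → ℤ} (i : I) {p q : ℤ} {x y : Alg R}
    (hx : x ∈ homog R ω d p) (hy : y ∈ homog R ω d q) :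
    prod R i x y ∈ homog R ω d (p + q + ω i) := by
  induction hx using Submodule.span_induction with
  | zero => simp
  | add x x' _ _ h h' => simpa using add_mem h h'
  | smul c x _ h => simpa using Submodule.smul_mem _ c h
  | mem x hx =>
    obtain ⟨s, rfl, rfl⟩ := hx
    induction hy using Submodule.span_induction with
    | zero => simp
    | add x x' _ _ h h' => simpa using add_mem h h'
    | smul c x _ h => simpa using Submodule.smul_mem _ c h
    | mem y hy =>
      obtain ⟨t, rfl, rfl⟩ := hy
      exact Submodule.subset_span ⟨Mono.op i s t, rfl, prod_cls R i s t⟩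

namespace Formal

@[ext] theorem ext_coeff {x y : Formal R} (h : ∀ n, coeff n x = coeff n y) : x = y :=
  Subtype.ext (funext h)

/-- The component of order `n`, as a linear map. -/
noncomputable def coeffₗ (R : Set (NonAssoc K I A)) (n : ℕ) : Formal R →ₗ[K] Alg R :=
  (LinearMap.proj n).comp (Submodule.subtype _)

@[simp] theorem coeff_zero (n : ℕ) : coeff n (0 : Formal R) = 0 := rfl

@[simp] theorem coeff_add (n : ℕ) (x y : Formal R) : coeff n (x + y) = coeff n x + coeff n y :=
  rfl

@[simp] theorem coeff_sub (n : ℕ) (x y : Formal R) : coeff n (x - y) = coeff n x - coeff n y :=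
  rfl

@[simp] theorem coeff_smul (n : ℕ) (c : K) (x : Formal R) : coeff n (c • x) = c • coeff n x :=
  rfl

@[simp] theorem coeff_sum {ι : Type*} (n : ℕ) (s : Finset ι) (f : ι → Formal R) :
    coeff n (∑ k ∈ s, f k) = ∑ k ∈ s, coeff n (f k) :=
  map_sum (coeffₗ R n) f s

theorem coeff_mul (i : I) (n : ℕ) (x y : Formal R) :
    coeff n (mul i x y) = ∑ k ∈ Finset.HasAntidiagonal.antidiagonal n,
      prod R i (coeff k.1 x) (coeff k.2 y) := rfl

/-- The product of formal sums, as a bilinear map. -/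
noncomputable def mulₗ (R : Set (NonAssoc K I A)) (i : I) :
    Formal R →ₗ[K] Formal R →ₗ[K] Formal R :=
  LinearMap.mk₂ K (mul i)
    (fun x x' y => by ext n; simp [coeff_mul, Finset.sum_add_distrib])
    (fun c x y => by ext n; simp [coeff_mul, Finset.smul_sum])
    (fun x y y' => by ext n; simp [coeff_mul, Finset.sum_add_distrib])
    (fun c x y => by ext n; simp [coeff_mul, Finset.smul_sum])

@[simp] theorem mulₗ_apply (i : I) (x y : Formal R) : mulₗ R i x y = mul i x y := rfl

@[simp] protected theorem mul_zero (i : I) (x : Formal R) : mul i x 0 = 0 := (mulₗ R i x).map_zero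
@[simp] protected theorem zero_mul (i : I) (x : Formal R) : mul i 0 x = 0 := (mulₗ R i).map_zero₂ x

protected theorem mul_add (i : I) (x y z : Formal R) : mul i x (y + z) = mul i x y + mul i x z :=
  (mulₗ R i x).map_add y z

protected theorem add_mul (i : I) (x y z : Formal R) : mul i (x + y) z = mul i x z + mul i y z :=
  (mulₗ R i).map_add₂ x y z

protected theorem mul_sub (i : I) (x y z : Formal R) : mul i x (y - z) = mul i x y - mul i x z :=
  (mulₗ R i x).map_sub y z

protected theorem sub_mul (i : I) (x y z : Formal R) : mul i (x - y) z = mul i x z - mul i y z :=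
  (mulₗ R i).map_sub₂ x y z

protected theorem mul_smul (i : I) (c : K) (x y : Formal R) : mul i x (c • y) = c • mul i x y :=
  (mulₗ R i x).map_smul c y

protected theorem smul_mul (i : I) (c : K) (x y : Formal R) : mul i (c • x) y = c • mul i x y :=
  (mulₗ R i).map_smul₂ c x y

/-! #### Order -/

theorem OrderGE.zero (n : ℕ) : OrderGE n (0 : Formal R) := fun _ _ => rfl

theorem OrderGE.add {n : ℕ} {x y : Formal R} (hx : OrderGE n x) (hy : OrderGE n y) :
    OrderGE n (x + y) := fun m hm => by simp [hx m hm, hy m hm]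

theorem OrderGE.sub {n : ℕ} {x y : Formal R} (hx : OrderGE n x) (hy : OrderGE n y) :
    OrderGE n (x - y) := fun m hm => by simp [hx m hm, hy m hm]

theorem OrderGE.smul {n : ℕ} {x : Formal R} (c : K) (hx : OrderGE n x) :
    OrderGE n (c • x) := fun m hm => by simp [hx m hm]

theorem OrderGE.mul (i : I) {m n : ℕ} {x y : Formal R} (hx : OrderGE m x) (hy : OrderGE n y) :
    OrderGE (m + n) (mul i x y) := by
  intro k hk
  rw [coeff_mul]
  refine Finset.sum_eq_zero fun l hl => ?_
  rw [Finset.HasAntidiagonal.mem_antidiagonal] at hl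
  rcases lt_or_ge l.1 m with h | h
  · simp [hx _ h]
  · simp [hy l.2 (by omega)]

theorem OrderGE.mul_left (i : I) {n : ℕ} {x : Formal R} (y : Formal R) (hx : OrderGE n x) :
    OrderGE n (Formal.mul i x y) := hx.mul i (n := 0) (y := y) fun _ h => absurd h (Nat.not_lt_zero _)

theorem OrderGE.mul_right (i : I) {n : ℕ} (x : Formal R) {y : Formal R} (hy : OrderGE n y) :
    OrderGE n (Formal.mul i x y) := by
  have := OrderGE.mul i (m := 0) (x := x) (fun _ h => absurd h (Nat.not_lt_zero _)) hy
  rwa [Nat.zero_add] at this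

/-! #### Degree -/

section Degree

variable {ω : I → ℤ} {d : A → ℤ} {p q : ℤ} {x y : Formal R}

theorem IsHomog.add (hx : IsHomog ω d p x) (hy : IsHomog ω d p y) : IsHomog ω d p (x + y) :=
  fun n => add_mem (hx n) (hy n)

theorem IsHomog.sub (hx : IsHomog ω d p x) (hy : IsHomog ω d p y) : IsHomog ω d p (x - y) :=
  fun n => sub_mem (hx n) (hy n)

theorem IsHomog.smul (c : K) (hx : IsHomog ω d p x) : IsHomog ω d p (c • x) :=
  fun n => Submodule.smul_mem _ c (hx n)

theorem IsHomog.mul (i : I) (hx : IsHomog ω d p x) (hy : IsHomog ω d q y) :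
    IsHomog ω d (p + q + ω i) (mul i x y) :=
  fun n => by
    rw [coeff_mul]
    exact Submodule.sum_mem _ fun k _ => prod_mem_homog i (hx k.1) (hy k.2)

theorem IsHomog.congr (hx : IsHomog ω d p x) (h : p = q) : IsHomog ω d q x := h ▸ hx

end Degree

/-! #### Finiteness -/

theorem IsFinite.zero : IsFinite (0 : Formal R) := ⟨0, fun _ _ => rfl⟩

theorem IsFinite.add {x y : Formal R} : IsFinite x → IsFinite y → IsFinite (x + y)
  | ⟨M, hM⟩, ⟨N, hN⟩ => ⟨max M N, fun n hn => by
    rw [coeff_add, hM n (le_of_max_le_left hn), hN n (le_of_max_le_right hn), add_zero]⟩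

theorem IsFinite.smul (c : K) {x : Formal R} : IsFinite x → IsFinite (c • x)
  | ⟨M, hM⟩ => ⟨M, fun n hn => by rw [coeff_smul, hM n hn, smul_zero]⟩

theorem IsFinite.sub {x y : Formal R} : IsFinite x → IsFinite y → IsFinite (x - y)
  | ⟨M, hM⟩, ⟨N, hN⟩ => ⟨max M N, fun n hn => by
    rw [coeff_sub, hM n (le_of_max_le_left hn), hN n (le_of_max_le_right hn), sub_zero]⟩

theorem IsFinite.mul (i : I) {x y : Formal R} : IsFinite x → IsFinite y → IsFinite (mul i x y)
  | ⟨M, hM⟩, ⟨N, hN⟩ => ⟨M + N, fun n hn => by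
    rw [coeff_mul]
    refine Finset.sum_eq_zero fun l hl => ?_
    rw [Finset.HasAntidiagonal.mem_antidiagonal] at hl
    rcases lt_or_ge l.1 M with h | h
    · simp [hN l.2 (by omega)]
    · simp [hM _ h]⟩

/-! #### Monomials as formal sums -/

/-- A monomial, as a formal sum. -/
noncomputable def ofMono (t : Mono I A) : Formal R :=
  ⟨Pi.single t.len (cls R t), by
    intro n _
    by_cases h : n = t.len
    · subst h
      rw [Pi.single_eq_same]
      exact Submodule.subset_span (Exists.intro t (And.intro rfl rfl))
    · simp [Pi.single_eq_of_ne h]⟩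

theorem coeff_ofMono (n : ℕ) (t : Mono I A) :
    coeff n (ofMono t : Formal R) = if n = t.len then cls R t else 0 := by
  change (Pi.single t.len (cls R t) : ℕ → Alg R) n = _
  rw [Pi.single_apply]

theorem mul_ofMono (i : I) (s t : Mono I A) :
    mul i (ofMono s) (ofMono t) = (ofMono (.op i s t) : Formal R) := by
  ext n
  rw [coeff_mul, coeff_ofMono]
  split_ifs with h
  · subst h
    rw [Finset.sum_eq_single (s.len, t.len)]
    · simp [coeff_ofMono, prod_cls]
    · rintro ⟨k, l⟩ - hne
      simp only [coeff_ofMono]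
      split_ifs with h1 h2 <;> simp_all
    · simp [Mono.len]
  · refine Finset.sum_eq_zero fun k hk => ?_
    rw [Finset.HasAntidiagonal.mem_antidiagonal] at hk
    simp only [coeff_ofMono]
    split_ifs with h1 h2
    · exact absurd (by simp [Mono.len, ← hk, h1, h2]) h
    all_goals simp

theorem incl_single (a : A) : incl R (Finsupp.single a 1) = ofMono (.gen a) := by
  simp [incl, ofMono, Mono.len]

theorem ofMono_isHomog (ω : I → ℤ) (d : A → ℤ) (t : Mono I A) :
    IsHomog ω d (t.deg ω d) (ofMono t : Formal R) := by
  intro n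
  rw [coeff_ofMono]
  split_ifs
  · exact Submodule.subset_span ⟨t, rfl, rfl⟩
  · exact Submodule.zero_mem _

theorem ofMono_orderGE (t : Mono I A) : OrderGE t.len (ofMono t : Formal R) := by
  intro n hn
  rw [coeff_ofMono, if_neg hn.ne]

theorem ofMono_isFinite (t : Mono I A) : IsFinite (ofMono t : Formal R) :=
  ⟨t.len + 1, fun n hn => by rw [coeff_ofMono, if_neg (by omega)]⟩

end Formal

open Formal

/-- The relations are homogeneous with respect to the order in the generators. -/
class OrderHomogeneous (R : Set (NonAssoc K I A)) : Prop where
  exists_order : ∀ r ∈ R, ∃ n, r ∈ Submodule.span K {x | ∃ t : Mono I A, t.len = n ∧ x = mono K t}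

theorem toFormal_of_mem {n : ℕ} {x : NonAssoc K I A}
    (hx : x ∈ Submodule.span K {x | ∃ t : Mono I A, t.len = n ∧ x = mono K t}) (m : ℕ) :
    coeff (R := R) m (onMono (ofMono (R := R)) x) = if m = n then (ideal R).mkQ x else 0 := by
  induction hx using Submodule.span_induction with
  | zero => simp
  | add x y _ _ hx hy => rw [map_add, coeff_add, hx, hy]; split_ifs <;> simp
  | smul c x _ hx => rw [map_smul, coeff_smul, hx]; split_ifs <;> simp
  | mem x hx =>
    obtain ⟨t, rfl, rfl⟩ := hx
    rw [onMono_mono, coeff_ofMono]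
    rfl

/-- A relation lives in one order, so each component of its image is either 0 or the class of the
relation itself, which is 0 in the quotient. This is what makes the components of an element of the
quotient well defined. -/
theorem ideal_le_ker_ofMono [hR : OrderHomogeneous R] :
    ideal R ≤ LinearMap.ker (onMono (ofMono (R := R))) := by
  have hmul : ∀ (i : I) (x y : NonAssoc K I A), onMono (ofMono (R := R)) (NonAssoc.mul i x y)
      = mul i (onMono (ofMono (R := R)) x) (onMono (ofMono (R := R)) y) := by
    intro i x y
    have h : (NonAssoc.mul i).compr₂ (onMono (ofMono (R := R)))
        = (mulₗ R i).compl₁₂ (onMono (ofMono (R := R))) (onMono (ofMono (R := R))) := by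
      refine NonAssoc.hom_ext fun s => NonAssoc.hom_ext fun t => ?_
      simp [NonAssoc.mul_mono, mul_ofMono]
    exact LinearMap.congr_fun₂ h x y
  refine ideal_le ?_ ?_
  · intro r hr
    obtain ⟨n, hn⟩ := hR.exists_order r hr
    rw [SetLike.mem_coe, LinearMap.mem_ker]
    ext m
    rw [toFormal_of_mem hn]
    have : (ideal R).mkQ r = 0 := (Submodule.Quotient.mk_eq_zero _).2 (subset_ideal R hr)
    simp [this]
  · intro i x y h
    simp only [LinearMap.mem_ker, hmul] at h ⊢
    rcases h with h | h <;> simp [h]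

/-- The inclusion of the finite sums into the formal sums. -/
noncomputable def ofAlg (R : Set (NonAssoc K I A)) [OrderHomogeneous R] : Alg R →ₗ[K] Formal R :=
  (ideal R).liftQ (onMono ofMono) ideal_le_ker_ofMono

@[simp] theorem ofAlg_cls [OrderHomogeneous R] (t : Mono I A) :
    ofAlg R (cls R t) = ofMono t := by
  change onMono ofMono (mono K t) = _
  simp

theorem coeff_ofAlg [OrderHomogeneous R] {n : ℕ} {x : Alg R} (hx : x ∈ weight R n) (m : ℕ) :
    coeff (R := R) m (ofAlg R x) = if m = n then x else 0 := by
  induction hx using Submodule.span_induction with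
  | zero => simp
  | add x y _ _ hx hy => rw [map_add, coeff_add, hx, hy]; split_ifs <;> simp
  | smul c x _ hx => rw [map_smul, coeff_smul, hx]; split_ifs <;> simp
  | mem x hx =>
    obtain ⟨t, rfl, rfl⟩ := hx
    rw [ofAlg_cls, coeff_ofMono]

theorem coeff_sum_ofAlg [OrderHomogeneous R] (N n : ℕ) (x : Formal R) :
    coeff n (∑ m ∈ Finset.range N, ofAlg R (coeff m x)) = if n < N then coeff n x else 0 := by
  have h : ∀ m, coeff n (ofAlg R (coeff m x)) = if n = m then coeff m x else 0 := fun m =>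
    coeff_ofAlg (x.2 m trivial) n
  rw [coeff_sum, Finset.sum_congr rfl fun m _ => h m]
  simp

/-- Reduces preservation of finite sums to the case of a single monomial. -/
theorem Formal.IsFinite.mem_span [OrderHomogeneous R] {x : Formal R} (hx : IsFinite x) :
    x ∈ Submodule.span K (Set.range (ofMono (R := R))) := by
  obtain ⟨N, hN⟩ := hx
  have h : x = ∑ m ∈ Finset.range N, ofAlg R (coeff m x) := by
    ext n
    rw [coeff_sum_ofAlg]
    split_ifs with hn
    · rfl
    · exact hN n (not_lt.1 hn)
  rw [h]
  refine Submodule.sum_mem _ fun m _ => ?_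
  have hm := x.2 m trivial
  change coeff m x ∈ _ at hm
  generalize coeff m x = y at hm
  induction hm using Submodule.span_induction with
  | zero => simp
  | add x x' _ _ h h' => rw [map_add]; exact add_mem h h'
  | smul c x _ h => rw [map_smul]; exact Submodule.smul_mem _ c h
  | mem x hx =>
    obtain ⟨t, rfl, rfl⟩ := hx
    rw [ofAlg_cls]
    exact Submodule.subset_span ⟨t, rfl⟩

/-- Linear maps that preserve the filtration by order are determined by the monomials. -/
theorem Formal.eq_of_ofMono [OrderHomogeneous R] (P : Mono I A → Prop)
    {F G : Formal R →ₗ[K] Formal R'}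
    (hF : ∀ n x, OrderGE n x → OrderGE n (F x)) (hG : ∀ n x, OrderGE n x → OrderGE n (G x))
    (h : ∀ t, P t → F (ofMono t) = G (ofMono t)) {x : Formal R}
    (hx : ∀ n, coeff n x ∈ Submodule.span K {y | ∃ t, P t ∧ y = cls R t}) : F x = G x := by
  have key : ∀ m, F (ofAlg R (coeff m x)) = G (ofAlg R (coeff m x)) := by
    intro m
    have hm := hx m
    generalize coeff m x = y at hm ⊢
    induction hm using Submodule.span_induction with
    | zero => simp
    | add x x' _ _ h h' => simp [h, h']
    | smul c x _ h => simp [h]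
    | mem x hx =>
      obtain ⟨t, ht, rfl⟩ := hx
      rw [ofAlg_cls, h t ht]
  ext n
  -- Density argument: the tail beyond order `n` has no effect on the component of order `n` of the
  -- image, so `x` may be replaced by a finite truncation, where `key` applies.
  have hn : OrderGE (n + 1) (x - ∑ m ∈ Finset.range (n + 1), ofAlg R (coeff m x)) := by
    intro k hk
    rw [coeff_sub, coeff_sum_ofAlg, if_pos hk, sub_self]
  have h1 := hF _ _ hn n n.lt_succ_self
  have h2 := hG _ _ hn n n.lt_succ_self
  rw [map_sub, coeff_sub, sub_eq_zero] at h1 h2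
  rw [h1, h2, map_sum, map_sum, Finset.sum_congr rfl fun m _ => key m]

theorem Formal.hom_ext [OrderHomogeneous R] {F G : Formal R →ₗ[K] Formal R'}
    (hF : ∀ n x, OrderGE n x → OrderGE n (F x)) (hG : ∀ n x, OrderGE n x → OrderGE n (G x))
    (h : ∀ t, F (ofMono t) = G (ofMono t)) : F = G := by
  refine LinearMap.ext fun x => eq_of_ofMono (fun _ => True) hF hG (fun t _ => h t) fun n => ?_
  refine Submodule.span_mono ?_ (x.2 n trivial)
  rintro y ⟨t, -, rfl⟩
  exact ⟨t, trivial, rfl⟩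

/-- Extension by continuity of a linear map that preserves the filtration by order. -/
noncomputable def extend (F : Alg R →ₗ[K] Formal R') : Formal R →ₗ[K] Formal R' where
  -- For the intended `F`, parts of order `m > n` contribute nothing in order `n`, so cutting off at
  -- `m ≤ n` loses nothing and keeps the sum finite.
  toFun x := ⟨fun n => ∑ m ∈ Finset.range (n + 1), coeff n (F (coeff m x)),
    fun n _ => Submodule.sum_mem _ fun m _ => (F (coeff m x)).2 n trivial⟩
  map_add' x y := by
    ext n
    change ∑ m ∈ Finset.range (n + 1), coeff n (F (coeff m (x + y))) =
      ∑ m ∈ Finset.range (n + 1), coeff n (F (coeff m x)) +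
        ∑ m ∈ Finset.range (n + 1), coeff n (F (coeff m y))
    simp [Finset.sum_add_distrib]
  map_smul' c x := by
    ext n
    change ∑ m ∈ Finset.range (n + 1), coeff n (F (coeff m (c • x))) =
      c • ∑ m ∈ Finset.range (n + 1), coeff n (F (coeff m x))
    simp [Finset.smul_sum]

theorem coeff_extend (F : Alg R →ₗ[K] Formal R') (n : ℕ) (x : Formal R) :
    coeff n (extend F x) = ∑ m ∈ Finset.range (n + 1), coeff n (F (coeff m x)) := rfl

theorem extend_ofMono {F : Alg R →ₗ[K] Formal R'} (hF : ∀ t, OrderGE t.len (F (cls R t)))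
    (t : Mono I A) : extend F (ofMono t) = F (cls R t) := by
  ext n
  rw [coeff_extend]
  by_cases h : t.len < n + 1
  · rw [Finset.sum_eq_single t.len]
    · rw [coeff_ofMono, if_pos rfl]
    · intro m _ hm
      rw [coeff_ofMono, if_neg hm, map_zero, coeff_zero]
    · simp [h]
  · rw [hF t n (by omega)]
    refine Finset.sum_eq_zero fun m hm => ?_
    rw [Finset.mem_range] at hm
    rw [coeff_ofMono, if_neg (by omega), map_zero, coeff_zero]

/-- Automatic for every `F`, because of the cutoff built into `extend`. -/
theorem extend_orderGE (F : Alg R →ₗ[K] Formal R') (n : ℕ) (x : Formal R) (hx : OrderGE n x) :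
    OrderGE n (extend F x) := by
  intro m hm
  rw [coeff_extend]
  refine Finset.sum_eq_zero fun k hk => ?_
  rw [Finset.mem_range] at hk
  rw [hx k (by omega), map_zero, coeff_zero]

/-- The shift `k` is 1 for differentials and 0 for morphisms. -/
theorem extend_isHomog {ω : I → ℤ} {d : A → ℤ} {ω' : J → ℤ} {d' : B → ℤ}
    {F : Alg R →ₗ[K] Formal R'} {k : ℤ}
    (hF : ∀ t, IsHomog ω' d' (t.deg ω d + k) (F (cls R t))) (p : ℤ) (x : Formal R)
    (hx : IsHomog ω d p x) : IsHomog ω' d' (p + k) (extend F x) := by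
  intro n
  rw [coeff_extend]
  refine Submodule.sum_mem _ fun m _ => ?_
  have hm := hx m
  generalize coeff m x = y at hm ⊢
  induction hm using Submodule.span_induction with
  | zero => simp
  | add x x' _ _ h h' => rw [map_add]; exact add_mem h h'
  | smul c x _ h => rw [map_smul]; exact Submodule.smul_mem _ c h
  | mem x hx =>
    obtain ⟨t, rfl, rfl⟩ := hx
    exact hF t n

/-- A cubic identity between products holds for homogeneous formal sums if it holds for
monomials. -/
theorem Formal.cubic_of_ofMono [OrderHomogeneous R] {ω : I → ℤ} {d : A → ℤ} {p q r : ℤ}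
    {i j k₁ l₁ k₂ l₂ k₃ l₃ k₄ l₄ : I} {c₁ c₂ c₃ c₄ : K}
    (h : ∀ a b c : Mono I A, a.deg ω d = p → b.deg ω d = q → c.deg ω d = r →
      (ofMono (.op i a (.op j b c)) : Formal R) =
        c₁ • ofMono (.op k₁ (.op l₁ a b) c) + c₂ • ofMono (.op k₂ (.op l₂ b a) c)
        + c₃ • ofMono (.op k₃ (.op l₃ c a) b) + c₄ • ofMono (.op k₄ (.op l₄ c b) a))
    {x y z : Formal R} (hx : IsHomog ω d p x) (hy : IsHomog ω d q y) (hz : IsHomog ω d r z) :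
    mul i x (mul j y z) =
      c₁ • mul k₁ (mul l₁ x y) z + c₂ • mul k₂ (mul l₂ y x) z
      + c₃ • mul k₃ (mul l₃ z x) y + c₄ • mul k₄ (mul l₄ z y) x := by
  -- Both sides are linear and filtered in each variable separately, so `x`, `y`, `z` are replaced
  -- by monomials one at a time, keeping track of the degree on which the signs depend.
  refine eq_of_ofMono (fun t => t.deg ω d = p) (x := x)
    (F := (mulₗ R i).flip (mul j y z))
    (G := c₁ • (mulₗ R k₁).flip z ∘ₗ (mulₗ R l₁).flip y + c₂ • (mulₗ R k₂).flip z ∘ₗ mulₗ R l₂ y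
      + c₃ • (mulₗ R k₃).flip y ∘ₗ mulₗ R l₃ z + c₄ • mulₗ R k₄ (mul l₄ z y))
    (fun n x h => h.mul_left _ _)
    (fun n x h => ((((h.mul_left _ _).mul_left _ _).smul _).add
      (((h.mul_right _ _).mul_left _ _).smul _)).add
      (((h.mul_right _ _).mul_left _ _).smul _) |>.add ((h.mul_right _ _).smul _)) ?_ hx
  intro a ha
  refine eq_of_ofMono (fun t => t.deg ω d = q) (x := y)
    (F := mulₗ R i (ofMono a) ∘ₗ (mulₗ R j).flip z)
    (G := c₁ • (mulₗ R k₁).flip z ∘ₗ mulₗ R l₁ (ofMono a)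
      + c₂ • (mulₗ R k₂).flip z ∘ₗ (mulₗ R l₂).flip (ofMono a)
      + c₃ • mulₗ R k₃ (mul l₃ z (ofMono a)) + c₄ • (mulₗ R k₄).flip (ofMono a) ∘ₗ mulₗ R l₄ z)
    (fun n x h => (h.mul_left _ _).mul_right _ _)
    (fun n x h => ((((h.mul_right _ _).mul_left _ _).smul _).add
      (((h.mul_left _ _).mul_left _ _).smul _)).add
      ((h.mul_right _ _).smul _) |>.add (((h.mul_right _ _).mul_left _ _).smul _)) ?_ hy
  intro b hb
  refine eq_of_ofMono (fun t => t.deg ω d = r) (x := z)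
    (F := mulₗ R i (ofMono a) ∘ₗ mulₗ R j (ofMono b))
    (G := c₁ • mulₗ R k₁ (mul l₁ (ofMono a) (ofMono b))
      + c₂ • mulₗ R k₂ (mul l₂ (ofMono b) (ofMono a))
      + c₃ • (mulₗ R k₃).flip (ofMono b) ∘ₗ (mulₗ R l₃).flip (ofMono a)
      + c₄ • (mulₗ R k₄).flip (ofMono a) ∘ₗ (mulₗ R l₄).flip (ofMono b))
    (fun n x h => (h.mul_right _ _).mul_right _ _)
    (fun n x h => (((h.mul_right _ _).smul _).add ((h.mul_right _ _).smul _)).add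
      (((h.mul_left _ _).mul_left _ _).smul _) |>.add
        (((h.mul_left _ _).mul_left _ _).smul _)) ?_ hz
  intro c hc
  simpa [mul_ofMono] using h a b c ha hb hc

end FormalSums

/-! ### Sign arithmetic, and the `Eilh` relations for homogeneous formal sums. -/

section Relations

variable {K : Type*} [Field K] {A : Type*} {d : A → ℤ}

open Formal

theorem sgn_one : sgn K 1 = -1 := by simp [sgn]

/-- Squares have the parity of their root; this removes the `i * i` exponents in the sign
comparisons below. -/
theorem sgn_mul_self_index (n : ℤ) : sgn K (n * n) = sgn K n := by
  rcases Int.even_or_odd n with h | h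
  · rw [sgn, sgn, Int.negOnePow_even _ h, Int.negOnePow_even _ (h.mul_left n)]
  · rw [sgn, sgn, Int.negOnePow_odd _ h, Int.negOnePow_odd _ (h.mul h)]

theorem sgn_mul_two (n : ℤ) : sgn K (n * 2) = 1 := by
  rw [mul_two, sgn_add, sgn_mul_self]

theorem sgn_mul_three (n : ℤ) : sgn K (n * 3) = sgn K n := by
  rw [show n * 3 = n * 2 + n by ring, sgn_add, sgn_mul_two, one_mul]

theorem sgn_two : sgn K 2 = 1 := by simpa using sgn_mul_two (K := K) 1

theorem sgn_three : sgn K 3 = -1 := by simpa [sgn_one] using sgn_mul_three (K := K) 1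

theorem sgn_mul_sgn_mul (n : ℤ) (x : K) : sgn K n * (sgn K n * x) = x := by
  rw [← mul_assoc, sgn_mul_self, one_mul]

theorem mono_mem_order {I : Type*} {t : Mono I A} {n : ℕ} (h : t.len = n) :
    mono K t ∈ Submodule.span K {x | ∃ t : Mono I A, t.len = n ∧ x = mono K t} :=
  Submodule.subset_span ⟨t, h, rfl⟩

instance : OrderHomogeneous {x | SymRel K d x} where
  exists_order := by
    rintro _ (⟨a, b, c⟩ | ⟨a, b⟩)
    · exact ⟨a.len + b.len + c.len, sub_mem (mono_mem_order (by simp [Mono.len]))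
        (mono_mem_order (by simp [Mono.len]; omega))⟩
    · exact ⟨a.len + b.len, sub_mem (mono_mem_order (by simp [Mono.len]))
        (Submodule.smul_mem _ _ (mono_mem_order (by simp [Mono.len]; omega)))⟩

instance : OrderHomogeneous {x | EilhRel K d x} where
  exists_order := by
    rintro _ (⟨i, a, b, c⟩ | ⟨i, j, h, a, b, c⟩ | ⟨i, j, h, a, b, c⟩ | ⟨i, j, h, a, b, c⟩ |
      ⟨i, j, h, a, b, c⟩) <;> refine ⟨a.len + b.len + c.len, sub_mem ?_ ?_⟩ <;>
      repeat' first
        | refine add_mem ?_ ?_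
        | refine Submodule.smul_mem _ _ ?_
        | exact mono_mem_order (by simp only [Mono.len] <;> omega)

theorem ofMono_eq_of_rel {I : Type*} {R : Set (NonAssoc K I A)} [OrderHomogeneous R]
    {x y : NonAssoc K I A} (h : x - y ∈ R) :
    onMono (ofMono (R := R)) x = onMono (ofMono (R := R)) y := by
  have := ideal_le_ker_ofMono (subset_ideal R h)
  rwa [LinearMap.mem_ker, map_sub, sub_eq_zero] at this

variable {p q r : ℤ} {x y z : EilhHat K d}

theorem mul_mul_eq (i : ℕ) (hx : IsHomog eilhDeg d p x) (hy : IsHomog eilhDeg d q y)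
    (hz : IsHomog eilhDeg d r z) :
    mul i x (mul i y z) = sgn K (i * (p + 1)) • mul i (mul i x y) z
      + (sgn K (i * (p + 1)) * sgn K (i + p * q)) • mul i (mul i y x) z := by
  have := cubic_of_ofMono (R := {x | EilhRel K d x}) (ω := eilhDeg) (d := d) (i := i) (j := i)
    (p := p) (q := q) (r := r) (k₁ := i) (l₁ := i) (k₂ := i) (l₂ := i) (k₃ := 0) (l₃ := 0)
    (k₄ := 0) (l₄ := 0) (c₁ := sgn K (i * (p + 1)))
    (c₂ := sgn K (i * (p + 1)) * sgn K (i + p * q)) (c₃ := 0) (c₄ := 0) ?_ hx hy hz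
  · simpa only [zero_smul, add_zero] using this
  · rintro a b c rfl rfl rfl
    have := ofMono_eq_of_rel (R := {x | EilhRel K d x}) (EilhRel.eq i a b c)
    simpa only [map_add, map_smul, onMono_mono, smul_add, smul_smul, zero_smul, add_zero]
      using this

theorem mul_mul_lt {i j : ℕ} (h : i < j) (hx : IsHomog eilhDeg d p x)
    (hy : IsHomog eilhDeg d q y) (hz : IsHomog eilhDeg d r z) :
    mul i x (mul j y z) = sgn K (i * j + j * p) • mul j (mul i x y) z := by
  have := cubic_of_ofMono (R := {x | EilhRel K d x}) (ω := eilhDeg) (d := d) (i := i) (j := j)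
    (p := p) (q := q) (r := r) (k₁ := j) (l₁ := i) (k₂ := 0) (l₂ := 0) (k₃ := 0) (l₃ := 0)
    (k₄ := 0) (l₄ := 0) (c₁ := sgn K (i * j + j * p))
    (c₂ := 0) (c₃ := 0) (c₄ := 0) ?_ hx hy hz
  · simpa only [zero_smul, add_zero] using this
  · rintro a b c rfl rfl rfl
    have := ofMono_eq_of_rel (R := {x | EilhRel K d x}) (EilhRel.lt i j h a b c)
    simpa only [map_add, map_smul, onMono_mono, smul_add, smul_smul, zero_smul, add_zero]
      using this

theorem mul_mul_add_one (i : ℕ) (hx : IsHomog eilhDeg d p x)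
    (hy : IsHomog eilhDeg d q y) (hz : IsHomog eilhDeg d r z) :
    mul (i + 1) x (mul i y z) = sgn K (i * p + p * q) • mul (i + 1) (mul i y x) z := by
  have := cubic_of_ofMono (R := {x | EilhRel K d x}) (ω := eilhDeg) (d := d) (i := i + 1) (j := i)
    (p := p) (q := q) (r := r) (k₁ := 0) (l₁ := 0) (k₂ := i + 1) (l₂ := i) (k₃ := 0) (l₃ := 0)
    (k₄ := 0) (l₄ := 0) (c₁ := 0)
    (c₂ := sgn K (i * p + p * q)) (c₃ := 0) (c₄ := 0) ?_ hx hy hz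
  · simpa only [zero_smul, add_zero, zero_add] using this
  · rintro a b c rfl rfl rfl
    have := ofMono_eq_of_rel (R := {x | EilhRel K d x}) (EilhRel.gt_one i (i + 1) rfl a b c)
    simpa only [map_add, map_smul, onMono_mono, smul_add, smul_smul, zero_smul, add_zero, zero_add]
      using this

theorem mul_mul_add_two (i : ℕ) (hx : IsHomog eilhDeg d p x)
    (hy : IsHomog eilhDeg d q y) (hz : IsHomog eilhDeg d r z) :
    mul (i + 2) x (mul i y z) = sgn K (i * p + p * q) • mul (i + 2) (mul i y x) z
      + sgn K (i * (p + (i + 2) + 1) + (p + q) * r) • mul (i + 1) (mul (i + 1) z x) y := by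
  have := cubic_of_ofMono (R := {x | EilhRel K d x}) (ω := eilhDeg) (d := d) (i := i + 2) (j := i)
    (p := p) (q := q) (r := r) (k₁ := 0) (l₁ := 0) (k₂ := i + 2) (l₂ := i) (k₃ := i + 1)
    (l₃ := i + 1) (k₄ := 0) (l₄ := 0) (c₁ := 0) (c₂ := sgn K (i * p + p * q))
    (c₃ := sgn K (i * (p + (i + 2) + 1) + (p + q) * r)) (c₄ := 0) ?_ hx hy hz
  · simpa only [zero_smul, add_zero, zero_add] using this
  · rintro a b c rfl rfl rfl
    have := ofMono_eq_of_rel (R := {x | EilhRel K d x}) (EilhRel.gt_two i (i + 2) rfl a b c)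
    simpa only [map_add, map_smul, onMono_mono, smul_add, smul_smul, zero_smul, add_zero, zero_add,
      Nat.cast_add, Nat.cast_ofNat, Nat.add_one_sub_one, Nat.reduceSubDiff] using this

/-- The outer index is written `j + 1`, so that the lowered index is `j` and no truncated
subtraction occurs. -/
theorem mul_mul_gt {i j : ℕ} (h : i + 1 < j) (hx : IsHomog eilhDeg d p x)
    (hy : IsHomog eilhDeg d q y) (hz : IsHomog eilhDeg d r z) :
    mul (j + 1) x (mul i y z) = sgn K (i * p + p * q) • mul (j + 1) (mul i y x) z
      + sgn K (i * (p + (j + 1) + 1) + (p + q) * r) • mul (i + 1) (mul j z x) y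
      + sgn K ((j + 1) + p * (q + i) + (p + q) * r) • mul j (mul (i + 1) z y) x := by
  have := cubic_of_ofMono (R := {x | EilhRel K d x}) (ω := eilhDeg) (d := d) (i := j + 1)
    (j := i) (p := p) (q := q) (r := r) (k₁ := 0) (l₁ := 0) (k₂ := j + 1) (l₂ := i)
    (k₃ := i + 1) (l₃ := j) (k₄ := j) (l₄ := i + 1) (c₁ := 0) (c₂ := sgn K (i * p + p * q))
    (c₃ := sgn K (i * (p + (j + 1) + 1) + (p + q) * r))
    (c₄ := sgn K ((j + 1) + p * (q + i) + (p + q) * r)) ?_ hx hy hz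
  · simpa only [zero_smul, add_zero, zero_add] using this
  · rintro a b c rfl rfl rfl
    have := ofMono_eq_of_rel (R := {x | EilhRel K d x})
      (EilhRel.gt i (j + 1) (by omega) a b c)
    simpa only [map_add, map_smul, onMono_mono, smul_add, smul_smul, zero_smul, add_zero, zero_add,
      Nat.cast_add, Nat.cast_one, Nat.add_one_sub_one] using this

end Relations

/-! ### Compatibility of the deformed Leibniz rule with each quadratic relation. -/

section Compat

set_option linter.unusedSimpArgs false

variable {K : Type*} [Field K] {A : Type*} {d : A → ℤ}

open Formal

/-- The right-hand side of the deformed Leibniz rule for `x ⊘ᵢ y`, where `x'`, `y'` are the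
differentials of `x`, `y`, and `p`, `q` are the degrees of `x`, `y`. -/
noncomputable def leib (i : ℕ) (p q : ℤ) (x x' y y' : EilhHat K d) : EilhHat K d :=
  sgn K i • (mul i x' y + sgn K p • mul i x y') + sgn K i • mul (i + 1) x y
    - sgn K (p * q) • mul (i + 1) y x

variable {p q r : ℤ} {x x' y y' z z' : EilhHat K d}

/-- The primed elements are arbitrary of the right degree, so this and its companions are formal
consequences of the quadratic relations. The rule raises either the inner or the outer index by 1,
hence relations for adjacent index pairs are needed; since the shape of a relation changes with the
index difference, each small difference is a separate case. -/
theorem leib_mul_mul_eq (i : ℕ)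
    (hx : IsHomog eilhDeg d p x) (hx' : IsHomog eilhDeg d (p + 1) x')
    (hy : IsHomog eilhDeg d q y) (hy' : IsHomog eilhDeg d (q + 1) y')
    (hz : IsHomog eilhDeg d r z) (hz' : IsHomog eilhDeg d (r + 1) z') :
    leib i p (q + r + i) x x' (mul i y z) (leib i q r y y' z z') =
      sgn K (i * (p + 1)) •
        (leib i (p + q + i) r (mul i x y) (leib i p q x x' y y') z z'
          + sgn K (i + p * q) • leib i (q + p + i) r (mul i y x) (leib i q p y y' x x') z z') := by
  simp only [leib, Formal.mul_add, Formal.add_mul, Formal.mul_sub, Formal.sub_mul,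
    Formal.mul_smul, Formal.smul_mul]
  -- Every right-nested product is brought to left-nested form. Left-nested products then serve as
  -- atoms: no independence among them is needed, since their coefficients already agree as signs.
  rw [mul_mul_eq i hx' hy hz,
    mul_mul_eq i hx hy' hz,
    mul_mul_eq i hx hy hz',
    mul_mul_lt i.lt_succ_self hx hy hz,
    mul_mul_lt i.lt_succ_self hx hz hy,
    mul_mul_add_one i hx hy hz,
    mul_mul_add_one i hz hx hy,
    mul_mul_add_one i hz hy hx]
  match_scalars
  all_goals
    simp only [Nat.cast_add, Nat.cast_one, Nat.cast_ofNat, mul_add, add_mul, sgn_add,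
      sgn_mul_self_index, sgn_one, sgn_two, sgn_three, sgn_mul_two, sgn_mul_three, mul_one,
      one_mul, mul_neg, neg_mul,
      neg_neg, mul_assoc, mul_comm, mul_left_comm, sgn_mul_self, sgn_mul_sgn_mul]
  all_goals ring

/-- Raising the inactive index can leave the regime `i < j`: the pair `(i + 1, i + 1)` needs the
relation for equal indices, and the swapped term `z ⊘ᵢ₊₂ (x ⊘ᵢ y)` the one for difference 2. -/
theorem leib_mul_mul_lt_one (i : ℕ)
    (hx : IsHomog eilhDeg d p x) (hx' : IsHomog eilhDeg d (p + 1) x')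
    (hy : IsHomog eilhDeg d q y) (hy' : IsHomog eilhDeg d (q + 1) y')
    (hz : IsHomog eilhDeg d r z) (hz' : IsHomog eilhDeg d (r + 1) z') :
    leib i p (q + r + (i + 1)) x x' (mul (i + 1) y z) (leib (i + 1) q r y y' z z') =
      sgn K (i * (i + 1) + (i + 1) * p) • leib (i + 1) (p + q + i) r (mul i x y) (leib i p q x x' y y') z z' := by
  simp only [leib, Formal.mul_add, Formal.add_mul, Formal.mul_sub, Formal.sub_mul,
    Formal.mul_smul, Formal.smul_mul]
  rw [mul_mul_lt i.lt_succ_self hx' hy hz,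
    mul_mul_lt i.lt_succ_self hx hy' hz,
    mul_mul_lt i.lt_succ_self hx hy hz',
    mul_mul_lt (by omega : i < i + 1 + 1) hx hy hz,
    mul_mul_lt (by omega : i < i + 1 + 1) hx hz hy,
    mul_mul_eq (i + 1) hx hy hz,
    mul_mul_add_two i hz hx hy]
  match_scalars
  all_goals
    simp only [Nat.cast_add, Nat.cast_one, Nat.cast_ofNat, mul_add, add_mul, sgn_add,
      sgn_mul_self_index, sgn_one, sgn_two, sgn_three, sgn_mul_two, sgn_mul_three, mul_one,
      one_mul, mul_neg, neg_mul,
      neg_neg, mul_assoc, mul_comm, mul_left_comm, sgn_mul_self, sgn_mul_sgn_mul]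

theorem leib_mul_mul_lt_two {i j : ℕ} (h : i + 1 < j)
    (hx : IsHomog eilhDeg d p x) (hx' : IsHomog eilhDeg d (p + 1) x')
    (hy : IsHomog eilhDeg d q y) (hy' : IsHomog eilhDeg d (q + 1) y')
    (hz : IsHomog eilhDeg d r z) (hz' : IsHomog eilhDeg d (r + 1) z') :
    leib i p (q + r + j) x x' (mul j y z) (leib j q r y y' z z') =
      sgn K (i * j + j * p) • leib j (p + q + i) r (mul i x y) (leib i p q x x' y y') z z' := by
  simp only [leib, Formal.mul_add, Formal.add_mul, Formal.mul_sub, Formal.sub_mul,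
    Formal.mul_smul, Formal.smul_mul]
  rw [mul_mul_lt (by omega : i < j) hx' hy hz,
    mul_mul_lt (by omega : i < j) hx hy' hz,
    mul_mul_lt (by omega : i < j) hx hy hz',
    mul_mul_lt (by omega : i < j + 1) hx hy hz,
    mul_mul_lt (by omega : i < j + 1) hx hz hy,
    mul_mul_lt h hx hy hz,
    mul_mul_gt h hz hx hy]
  match_scalars
  all_goals
    simp only [Nat.cast_add, Nat.cast_one, Nat.cast_ofNat, mul_add, add_mul, sgn_add,
      sgn_mul_self_index, sgn_one, sgn_two, sgn_three, sgn_mul_two, sgn_mul_three, mul_one,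
      one_mul, mul_neg, neg_mul,
      neg_neg, mul_assoc, mul_comm, mul_left_comm, sgn_mul_self, sgn_mul_sgn_mul]
  all_goals ring

theorem leib_mul_mul_gt_one (i : ℕ)
    (hx : IsHomog eilhDeg d p x) (hx' : IsHomog eilhDeg d (p + 1) x')
    (hy : IsHomog eilhDeg d q y) (hy' : IsHomog eilhDeg d (q + 1) y')
    (hz : IsHomog eilhDeg d r z) (hz' : IsHomog eilhDeg d (r + 1) z') :
    leib (i + 1) p (q + r + i) x x' (mul i y z) (leib i q r y y' z z') =
      sgn K (i * p + p * q) •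
        leib (i + 1) (q + p + i) r (mul i y x) (leib i q p y y' x x') z z' := by
  simp only [leib, Formal.mul_add, Formal.add_mul, Formal.mul_sub, Formal.sub_mul,
    Formal.mul_smul, Formal.smul_mul]
  rw [mul_mul_add_one i hx' hy hz,
    mul_mul_add_one i hx hy' hz,
    mul_mul_add_one i hx hy hz',
    mul_mul_eq (i + 1) hx hy hz,
    mul_mul_eq (i + 1) hx hz hy,
    mul_mul_add_two i hx hy hz,
    mul_mul_add_two i hz hy hx]
  match_scalars
  all_goals
    simp only [Nat.cast_add, Nat.cast_one, Nat.cast_ofNat, mul_add, add_mul, sgn_add,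
      sgn_mul_self_index, sgn_one, sgn_two, sgn_three, sgn_mul_two, sgn_mul_three, mul_one,
      one_mul, mul_neg, neg_mul,
      neg_neg, mul_assoc, mul_comm, mul_left_comm, sgn_mul_self, sgn_mul_sgn_mul]
  all_goals ring

/-- Raising the inner index gives difference 1, raising the outer one gives difference 3, so all
three regimes of the second relation meet here. -/
theorem leib_mul_mul_gt_two (i : ℕ)
    (hx : IsHomog eilhDeg d p x) (hx' : IsHomog eilhDeg d (p + 1) x')
    (hy : IsHomog eilhDeg d q y) (hy' : IsHomog eilhDeg d (q + 1) y')
    (hz : IsHomog eilhDeg d r z) (hz' : IsHomog eilhDeg d (r + 1) z') :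
    leib (i + 2) p (q + r + i) x x' (mul i y z) (leib i q r y y' z z') =
      sgn K (i * p + p * q) •
        leib (i + 2) (q + p + i) r (mul i y x) (leib i q p y y' x x') z z'
      + sgn K (i * (p + (i + 2) + 1) + (p + q) * r) •
        leib (i + 1) (r + p + (i + 1)) q (mul (i + 1) z x) (leib (i + 1) r p z z' x x') y y' := by
  simp only [leib, Formal.mul_add, Formal.add_mul, Formal.mul_sub, Formal.sub_mul,
    Formal.mul_smul, Formal.smul_mul]
  rw [mul_mul_add_two i hx' hy hz,
    mul_mul_add_two i hx hy' hz,
    mul_mul_add_two i hx hy hz',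
    mul_mul_add_one (i + 1) hx hy hz,
    mul_mul_add_one (i + 1) hx hz hy,
    mul_mul_gt (by omega : i + 1 < i + 2) hx hy hz,
    mul_mul_gt (by omega : i + 1 < i + 2) hz hy hx,
    mul_mul_add_one (i + 1) hy hz hx]
  match_scalars
  all_goals
    simp only [Nat.cast_add, Nat.cast_one, Nat.cast_ofNat, mul_add, add_mul, sgn_add,
      sgn_mul_self_index, sgn_one, sgn_two, sgn_three, sgn_mul_two, sgn_mul_three, mul_one,
      one_mul, mul_neg, neg_mul,
      neg_neg, mul_assoc, mul_comm, mul_left_comm, sgn_mul_self, sgn_mul_sgn_mul]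
  all_goals ring

theorem leib_mul_mul_gt_three (i : ℕ)
    (hx : IsHomog eilhDeg d p x) (hx' : IsHomog eilhDeg d (p + 1) x')
    (hy : IsHomog eilhDeg d q y) (hy' : IsHomog eilhDeg d (q + 1) y')
    (hz : IsHomog eilhDeg d r z) (hz' : IsHomog eilhDeg d (r + 1) z') :
    leib (i + 3) p (q + r + i) x x' (mul i y z) (leib i q r y y' z z') =
      sgn K (i * p + p * q) •
        leib (i + 3) (q + p + i) r (mul i y x) (leib i q p y y' x x') z z'
      + sgn K (i * (p + (i + 3) + 1) + (p + q) * r) •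
        leib (i + 1) (r + p + (i + 2)) q (mul (i + 2) z x) (leib (i + 2) r p z z' x x') y y'
      + sgn K ((i + 3) + p * (q + i) + (p + q) * r) •
        leib (i + 2) (r + q + (i + 1)) p (mul (i + 1) z y) (leib (i + 1) r q z z' y y') x x' := by
  simp only [leib, Formal.mul_add, Formal.add_mul, Formal.mul_sub, Formal.sub_mul,
    Formal.mul_smul, Formal.smul_mul]
  rw [mul_mul_gt (by omega : i + 1 < i + 2) hx' hy hz,
    mul_mul_gt (by omega : i + 1 < i + 2) hx hy' hz,
    mul_mul_gt (by omega : i + 1 < i + 2) hx hy hz',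
    mul_mul_add_two (i + 1) hx hy hz,
    mul_mul_add_two (i + 1) hx hz hy,
    mul_mul_gt (by omega : i + 1 < i + 3) hx hy hz,
    mul_mul_gt (by omega : i + 1 < i + 3) hz hy hx,
    mul_mul_eq (i + 2) hy hz hx]
  match_scalars
  all_goals
    simp only [Nat.cast_add, Nat.cast_one, Nat.cast_ofNat, mul_add, add_mul, sgn_add,
      sgn_mul_self_index, sgn_one, sgn_two, sgn_three, sgn_mul_two, sgn_mul_three, mul_one,
      one_mul, mul_neg, neg_mul,
      neg_neg, mul_assoc, mul_comm, mul_left_comm, sgn_mul_self, sgn_mul_sgn_mul]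
  all_goals ring

/-- This is the generic case. It separates from difference 3 because of the term `y ⊘ᵢ₊₂ (z ⊘ⱼ x)`
on the right: its indices are equal for difference 3 and satisfy `i + 2 < j` here. -/
theorem leib_mul_mul_gt_four {i j : ℕ} (h : i + 2 < j)
    (hx : IsHomog eilhDeg d p x) (hx' : IsHomog eilhDeg d (p + 1) x')
    (hy : IsHomog eilhDeg d q y) (hy' : IsHomog eilhDeg d (q + 1) y')
    (hz : IsHomog eilhDeg d r z) (hz' : IsHomog eilhDeg d (r + 1) z') :
    leib (j + 1) p (q + r + i) x x' (mul i y z) (leib i q r y y' z z') =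
      sgn K (i * p + p * q) •
        leib (j + 1) (q + p + i) r (mul i y x) (leib i q p y y' x x') z z'
      + sgn K (i * (p + (j + 1) + 1) + (p + q) * r) •
        leib (i + 1) (r + p + j) q (mul j z x) (leib j r p z z' x x') y y'
      + sgn K ((j + 1) + p * (q + i) + (p + q) * r) •
        leib j (r + q + (i + 1)) p (mul (i + 1) z y) (leib (i + 1) r q z z' y y') x x' := by
  simp only [leib, Formal.mul_add, Formal.add_mul, Formal.mul_sub, Formal.sub_mul,
    Formal.mul_smul, Formal.smul_mul]
  rw [mul_mul_gt (by omega : i + 1 < j) hx' hy hz,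
    mul_mul_gt (by omega : i + 1 < j) hx hy' hz,
    mul_mul_gt (by omega : i + 1 < j) hx hy hz',
    mul_mul_gt h hx hy hz,
    mul_mul_gt h hx hz hy,
    mul_mul_gt (by omega : i + 1 < j + 1) hx hy hz,
    mul_mul_gt (by omega : i + 1 < j + 1) hz hy hx,
    mul_mul_lt (by omega : i + 1 + 1 < j) hy hz hx]
  match_scalars
  all_goals
    simp only [Nat.cast_add, Nat.cast_one, Nat.cast_ofNat, mul_add, add_mul, sgn_add,
      sgn_mul_self_index, sgn_one, sgn_two, sgn_three, sgn_mul_two, sgn_mul_three, mul_one,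
      one_mul, mul_neg, neg_mul,
      neg_neg, mul_assoc, mul_comm, mul_left_comm, sgn_mul_self, sgn_mul_sgn_mul]
  all_goals ring

end Compat

/-! ### The differential on the free `Eilh`-algebra with prescribed values on generators. -/

section Differential

variable {K : Type*} [Field K] {A : Type*} {d : A → ℤ}

open Formal

/-- The value on a monomial of the map that obeys the deformed Leibniz rule and is given by `δ`
on the generators. -/
noncomputable def diffMono (δ : A → EilhHat K d) : Mono ℕ A → EilhHat K d
  | .gen a => δ a
  | .op i s t => leib i (s.deg eilhDeg d) (t.deg eilhDeg d) (ofMono s) (diffMono δ s)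
      (ofMono t) (diffMono δ t)

theorem leib_isHomog {i : ℕ} {p q : ℤ} {x x' y y' : EilhHat K d}
    (hx : IsHomog eilhDeg d p x) (hx' : IsHomog eilhDeg d (p + 1) x')
    (hy : IsHomog eilhDeg d q y) (hy' : IsHomog eilhDeg d (q + 1) y') :
    IsHomog eilhDeg d (p + q + i + 1) (leib i p q x x' y y') := by
  refine IsHomog.sub (IsHomog.add (IsHomog.smul _ (IsHomog.add ?_ (IsHomog.smul _ ?_)))
    (IsHomog.smul _ ?_)) (IsHomog.smul _ ?_)
  · exact (hx'.mul i hy).congr (by simp only [eilhDeg]; ring)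
  · exact (hx.mul i hy').congr (by simp only [eilhDeg]; ring)
  · exact (hx.mul (i + 1) hy).congr (by simp only [eilhDeg]; push_cast; ring)
  · exact (hy.mul (i + 1) hx).congr (by simp only [eilhDeg]; push_cast; ring)

theorem leib_orderGE {i : ℕ} {p q : ℤ} {m n : ℕ} {x x' y y' : EilhHat K d}
    (hx : OrderGE m x) (hx' : OrderGE m x') (hy : OrderGE n y) (hy' : OrderGE n y') :
    OrderGE (m + n) (leib i p q x x' y y') :=
  ((((hx'.mul i hy).add ((hx.mul i hy').smul _)).smul _).add ((hx.mul (i + 1) hy).smul _)).sub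
    (OrderGE.smul _ (Nat.add_comm n m ▸ hy.mul (i + 1) hx))

theorem diffMono_isHomog {δ : A → EilhHat K d} (hδ : ∀ a, IsHomog eilhDeg d (d a + 1) (δ a))
    (t : Mono ℕ A) : IsHomog eilhDeg d (t.deg eilhDeg d + 1) (diffMono δ t) := by
  induction t with
  | gen a => exact hδ a
  | op i s t hs ht => exact leib_isHomog (ofMono_isHomog _ _ s) hs (ofMono_isHomog _ _ t) ht

theorem diffMono_orderGE {δ : A → EilhHat K d} (hδ : ∀ a, OrderGE 1 (δ a))
    (t : Mono ℕ A) : OrderGE t.len (diffMono δ t) := by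
  induction t with
  | gen a => exact hδ a
  | op i s t hs ht => exact leib_orderGE (ofMono_orderGE s) hs (ofMono_orderGE t) ht

/-- `t ↦ (-1)^(k |t|) t` on monomials. -/
noncomputable def twist (K : Type*) [Field K] (d : A → ℤ) (k : ℤ) :
    NonAssoc K ℕ A →ₗ[K] EilhHat K d :=
  onMono fun t => sgn K (k * t.deg eilhDeg d) • ofMono t

theorem twist_mono (k : ℤ) (t : Mono ℕ A) :
    twist K d k (mono K t) = sgn K (k * t.deg eilhDeg d) • ofMono t := onMono_mono _ _

/-- The Leibniz rule carries signs depending on degrees, whereas elements of the ideal need not be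
homogeneous. The maps `twist K d k` absorb these signs linearly, and multiplicativity makes their
kernels stable under products. -/
theorem twist_mul (k : ℤ) (i : ℕ) (x y : NonAssoc K ℕ A) :
    twist K d k (NonAssoc.mul i x y)
      = sgn K (k * i) • mul i (twist K d k x) (twist K d k y) := by
  have h : (NonAssoc.mul i).compr₂ (twist K d k)
      = sgn K (k * i) • (mulₗ _ i).compl₁₂ (twist K d k) (twist K d k) := by
    refine NonAssoc.hom_ext fun s => NonAssoc.hom_ext fun t => ?_
    simp only [LinearMap.compr₂_apply, LinearMap.smul_apply, LinearMap.compl₁₂_apply,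
      NonAssoc.mul_mono, twist_mono, mulₗ_apply, Formal.smul_mul, Formal.mul_smul, mul_ofMono,
      Mono.deg, eilhDeg, mul_add, sgn_add]
    module
  exact LinearMap.congr_fun₂ h x y

theorem mono_mem_degree {t : Mono ℕ A} {n : ℤ} (h : t.deg eilhDeg d = n) :
    mono K t ∈ Submodule.span K {x | ∃ t : Mono ℕ A, t.deg eilhDeg d = n ∧ x = mono K t} :=
  Submodule.subset_span ⟨t, h, rfl⟩

theorem EilhRel.exists_degree {x : NonAssoc K ℕ A} (hx : EilhRel K d x) : ∃ n : ℤ,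
    x ∈ Submodule.span K {x | ∃ t : Mono ℕ A, t.deg eilhDeg d = n ∧ x = mono K t} := by
  have key : ∀ (i j : ℕ) (a b c : Mono ℕ A) (y : NonAssoc K ℕ A),
      y ∈ Submodule.span K {x | ∃ t : Mono ℕ A, t.deg eilhDeg d =
        (Mono.op i a (.op j b c)).deg eilhDeg d ∧ x = mono K t} →
      ∃ n : ℤ, mono K (.op i a (.op j b c)) - y ∈
        Submodule.span K {x | ∃ t : Mono ℕ A, t.deg eilhDeg d = n ∧ x = mono K t} :=
    fun i j a b c y hy => ⟨_, sub_mem (mono_mem_degree rfl) hy⟩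
  rcases hx with ⟨i, a, b, c⟩ | ⟨i, j, h, a, b, c⟩ | ⟨i, j, h, a, b, c⟩ | ⟨i, j, h, a, b, c⟩ |
      ⟨i, j, h, a, b, c⟩ <;> apply key <;>
      repeat' first
        | refine add_mem ?_ ?_
        | refine Submodule.smul_mem _ _ ?_
        | exact mono_mem_degree (by simp only [Mono.deg, eilhDeg]; omega)

/-- Each relation is homogeneous in degree, so the twist only multiplies it by a global sign. -/
theorem twist_rel {x : NonAssoc K ℕ A} (hx : EilhRel K d x) (k : ℤ) : twist K d k x = 0 := by
  obtain ⟨n, hn⟩ := hx.exists_degree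
  have h : ∀ y ∈ Submodule.span K {x | ∃ t : Mono ℕ A, t.deg eilhDeg d = n ∧ x = mono K t},
      twist K d k y = sgn K (k * n) • onMono (ofMono (R := {x | EilhRel K d x})) y := by
    intro y hy
    induction hy using Submodule.span_induction with
    | zero => simp
    | add x y _ _ hx hy => rw [map_add, map_add, hx, hy, smul_add]
    | smul c x _ hx => rw [map_smul, map_smul, hx, smul_comm]
    | mem x hx =>
      obtain ⟨t, rfl, rfl⟩ := hx
      rw [twist_mono, onMono_mono]
  have h0 : onMono (ofMono (R := {x | EilhRel K d x})) x = 0 :=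
    ideal_le_ker_ofMono (subset_ideal {x | EilhRel K d x} hx)
  rw [h x hn, h0, smul_zero]

set_option linter.unusedSimpArgs false in
theorem onMono_diffMono_rel {δ : A → EilhHat K d}
    (hδ : ∀ a, IsHomog eilhDeg d (d a + 1) (δ a)) {x : NonAssoc K ℕ A} (hx : EilhRel K d x) :
    onMono (diffMono δ) x = 0 := by
  have h0 := fun t => ofMono_isHomog (R := {x | EilhRel K d x}) eilhDeg d t
  have h1 := diffMono_isHomog hδ
  rcases hx with ⟨i, a, b, c⟩ | ⟨i, j, h, a, b, c⟩ | ⟨i, j, h, a, b, c⟩ | ⟨i, j, h, a, b, c⟩ |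
      ⟨i, j, h, a, b, c⟩
  · have := leib_mul_mul_eq i (h0 a) (h1 a) (h0 b) (h1 b) (h0 c) (h1 c)
    simpa only [map_add, map_sub, map_smul, onMono_mono, sub_eq_zero, mul_ofMono, diffMono,
        Mono.deg, eilhDeg, Nat.cast_add, Nat.cast_one, Nat.cast_ofNat, Nat.reduceSubDiff,
        Nat.succ_eq_add_one, Nat.add_one_sub_one] using this
  -- The single relation for `i < j` splits here, because the compatibility computation differs for
  -- `j = i + 1`; the last relation splits likewise at `j = i + 3`.
  · obtain rfl | h := Nat.eq_or_lt_of_le h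
    · have := leib_mul_mul_lt_one i (h0 a) (h1 a) (h0 b) (h1 b) (h0 c) (h1 c)
      simpa only [map_add, map_sub, map_smul, onMono_mono, sub_eq_zero, mul_ofMono, diffMono,
        Mono.deg, eilhDeg, Nat.cast_add, Nat.cast_one, Nat.cast_ofNat, Nat.reduceSubDiff,
        Nat.succ_eq_add_one, Nat.add_one_sub_one] using this
    · have := leib_mul_mul_lt_two h (h0 a) (h1 a) (h0 b) (h1 b) (h0 c) (h1 c)
      simpa only [map_add, map_sub, map_smul, onMono_mono, sub_eq_zero, mul_ofMono, diffMono,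
        Mono.deg, eilhDeg, Nat.cast_add, Nat.cast_one, Nat.cast_ofNat, Nat.reduceSubDiff,
        Nat.succ_eq_add_one, Nat.add_one_sub_one] using this
  · subst h
    have := leib_mul_mul_gt_one i (h0 a) (h1 a) (h0 b) (h1 b) (h0 c) (h1 c)
    simpa only [map_add, map_sub, map_smul, onMono_mono, sub_eq_zero, mul_ofMono, diffMono,
        Mono.deg, eilhDeg, Nat.cast_add, Nat.cast_one, Nat.cast_ofNat, Nat.reduceSubDiff,
        Nat.succ_eq_add_one, Nat.add_one_sub_one] using this
  · subst h
    have := leib_mul_mul_gt_two i (h0 a) (h1 a) (h0 b) (h1 b) (h0 c) (h1 c)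
    simpa only [map_add, map_sub, map_smul, onMono_mono, sub_eq_zero, mul_ofMono, diffMono,
        Mono.deg, eilhDeg, Nat.cast_add, Nat.cast_one, Nat.cast_ofNat, Nat.reduceSubDiff,
        Nat.succ_eq_add_one, Nat.add_one_sub_one] using this
  · rcases Nat.lt_or_ge j (i + 4) with h' | h'
    · obtain rfl : j = i + 3 := by omega
      have := leib_mul_mul_gt_three i (h0 a) (h1 a) (h0 b) (h1 b) (h0 c) (h1 c)
      simpa only [map_add, map_sub, map_smul, onMono_mono, sub_eq_zero, mul_ofMono, diffMono,
        Mono.deg, eilhDeg, Nat.cast_add, Nat.cast_one, Nat.cast_ofNat, Nat.reduceSubDiff,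
        Nat.succ_eq_add_one, Nat.add_one_sub_one] using this
    · obtain ⟨j, rfl⟩ : ∃ k, j = k + 1 := ⟨j - 1, by omega⟩
      have := leib_mul_mul_gt_four (by omega : i + 2 < j) (h0 a) (h1 a) (h0 b) (h1 b) (h0 c) (h1 c)
      simpa only [map_add, map_sub, map_smul, onMono_mono, sub_eq_zero, mul_ofMono, diffMono,
        Mono.deg, eilhDeg, Nat.cast_add, Nat.cast_one, Nat.cast_ofNat, Nat.reduceSubDiff,
        Nat.succ_eq_add_one, Nat.add_one_sub_one] using this

theorem diffMono_mul_left {δ : A → EilhHat K d} (i : ℕ) (s : Mono ℕ A) (y : NonAssoc K ℕ A) :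
    onMono (diffMono δ) (NonAssoc.mul i (mono K s) y) =
      sgn K i • (mul i (diffMono δ s) (twist K d 0 y)
        + sgn K (s.deg eilhDeg d) • mul i (ofMono s) (onMono (diffMono δ) y))
      + sgn K i • mul (i + 1) (ofMono s) (twist K d 0 y)
      - mul (i + 1) (twist K d (s.deg eilhDeg d) y) (ofMono s) := by
  let F := fun i => mulₗ {x | EilhRel K d x} i
  have h : onMono (diffMono δ) ∘ₗ NonAssoc.mul i (mono K s) =
      sgn K i • (F i (diffMono δ s) ∘ₗ twist K d 0
        + sgn K (s.deg eilhDeg d) • F i (ofMono s) ∘ₗ onMono (diffMono δ))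
      + sgn K i • F (i + 1) (ofMono s) ∘ₗ twist K d 0
      - (F (i + 1)).flip (ofMono s) ∘ₗ twist K d (s.deg eilhDeg d) := by
    refine NonAssoc.hom_ext fun t => ?_
    simp [NonAssoc.mul_mono, twist_mono, diffMono, leib, F, sgn_zero]
  exact LinearMap.congr_fun h y

theorem diffMono_mul_right {δ : A → EilhHat K d} (i : ℕ) (t : Mono ℕ A) (x : NonAssoc K ℕ A) :
    onMono (diffMono δ) (NonAssoc.mul i x (mono K t)) =
      sgn K i • (mul i (onMono (diffMono δ) x) (ofMono t)
        + mul i (twist K d 1 x) (diffMono δ t))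
      + sgn K i • mul (i + 1) (twist K d 0 x) (ofMono t)
      - mul (i + 1) (ofMono t) (twist K d (t.deg eilhDeg d) x) := by
  let F := fun i => mulₗ {x | EilhRel K d x} i
  have h : onMono (diffMono δ) ∘ₗ (NonAssoc.mul i).flip (mono K t) =
      sgn K i • ((F i).flip (ofMono t) ∘ₗ onMono (diffMono δ)
        + (F i).flip (diffMono δ t) ∘ₗ twist K d 1)
      + sgn K i • (F (i + 1)).flip (ofMono t) ∘ₗ twist K d 0
      - F (i + 1) (ofMono t) ∘ₗ twist K d (t.deg eilhDeg d) := by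
    refine NonAssoc.hom_ext fun s => ?_
    simp [NonAssoc.mul_mono, twist_mono, diffMono, leib, F, sgn_zero, mul_comm]
  exact LinearMap.congr_fun h x

theorem ideal_le_ker_diffMono {δ : A → EilhHat K d}
    (hδ : ∀ a, IsHomog eilhDeg d (d a + 1) (δ a)) :
    ideal {x | EilhRel K d x} ≤ LinearMap.ker (onMono (diffMono δ)) := by
  -- The kernel of the recursively defined map alone is not visibly an ideal, since the rule for a
  -- product also involves the undifferentiated factors with signs. Intersecting with the kernels of
  -- all twists closes the induction.
  have hle : ideal {x | EilhRel K d x} ≤ LinearMap.ker (onMono (diffMono δ)) ⊓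
      ⨅ k, LinearMap.ker (twist K d k) := by
    refine ideal_le ?_ ?_
    · intro x hx
      simp only [SetLike.mem_coe, Submodule.mem_inf, Submodule.mem_iInf, LinearMap.mem_ker]
      exact ⟨onMono_diffMono_rel hδ hx, twist_rel hx⟩
    · intro i x y h
      simp only [Submodule.mem_inf, Submodule.mem_iInf, LinearMap.mem_ker] at h ⊢
      rcases h with ⟨h, h'⟩ | ⟨h, h'⟩
      · refine ⟨?_, fun k => by rw [twist_mul, h', Formal.zero_mul, smul_zero]⟩
        suffices onMono (diffMono δ) ∘ₗ NonAssoc.mul i x = 0 from LinearMap.congr_fun this y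
        refine NonAssoc.hom_ext fun t => ?_
        simp [diffMono_mul_right, h, h']
      · refine ⟨?_, fun k => by rw [twist_mul, h', Formal.mul_zero, smul_zero]⟩
        suffices onMono (diffMono δ) ∘ₗ (NonAssoc.mul i).flip y = 0 from
          LinearMap.congr_fun this x
        refine NonAssoc.hom_ext fun s => ?_
        simp [diffMono_mul_left, h, h']
  exact hle.trans inf_le_left

/-- The map that obeys the deformed Leibniz rule and is given by `δ` on the generators. -/
noncomputable def diff (δ : A → EilhHat K d) (hδ : ∀ a, IsHomog eilhDeg d (d a + 1) (δ a)) :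
    EilhHat K d →ₗ[K] EilhHat K d :=
  extend ((ideal {x | EilhRel K d x}).liftQ (onMono (diffMono δ)) (ideal_le_ker_diffMono hδ))

section

variable {δ : A → EilhHat K d} (hδ : ∀ a, IsHomog eilhDeg d (d a + 1) (δ a))

theorem liftQ_diffMono_cls (t : Mono ℕ A) :
    (ideal {x | EilhRel K d x}).liftQ (onMono (diffMono δ)) (ideal_le_ker_diffMono hδ)
      (cls _ t) = diffMono δ t :=
  onMono_mono _ t

theorem diff_isHomog (p : ℤ) (x : EilhHat K d) (hx : IsHomog eilhDeg d p x) :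
    IsHomog eilhDeg d (p + 1) (diff δ hδ x) :=
  extend_isHomog (fun t => by rw [liftQ_diffMono_cls hδ]; exact diffMono_isHomog hδ t) p x hx

theorem diff_orderGE (n : ℕ) (x : EilhHat K d) (hx : OrderGE n x) :
    OrderGE n (diff δ hδ x) := extend_orderGE _ n x hx

theorem diff_ofMono (hδ' : ∀ a, OrderGE 1 (δ a)) (t : Mono ℕ A) :
    diff δ hδ (ofMono t) = diffMono δ t := by
  rw [diff, extend_ofMono fun t => ?_, liftQ_diffMono_cls hδ]
  rw [liftQ_diffMono_cls hδ]
  exact diffMono_orderGE hδ' t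

theorem diff_leibniz (hδ' : ∀ a, OrderGE 1 (δ a)) (i : ℕ) (p q : ℤ) (x y : EilhHat K d)
    (hx : IsHomog eilhDeg d p x) (hy : IsHomog eilhDeg d q y) :
    diff δ hδ (mul i x y) = leib i p q x (diff δ hδ x) y (diff δ hδ y) := by
  let M := fun i => mulₗ {x | EilhRel K d x} i
  set D := diff δ hδ
  have hD := diff_orderGE hδ
  refine eq_of_ofMono (fun t => t.deg eilhDeg d = p) (x := x) (F := D ∘ₗ (M i).flip y)
    (G := sgn K i • ((M i).flip y ∘ₗ D + sgn K p • (M i).flip (D y))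
      + sgn K i • (M (i + 1)).flip y - sgn K (p * q) • M (i + 1) y)
    (fun n x h => hD _ _ (h.mul_left _ _))
    (fun n x h => (((((hD _ _ h).mul_left _ _).add ((h.mul_left _ _).smul _)).smul _).add
      ((h.mul_left _ _).smul _)).sub ((h.mul_right _ _).smul _)) ?_ hx
  rintro s rfl
  refine eq_of_ofMono (fun t => t.deg eilhDeg d = q) (x := y) (F := D ∘ₗ M i (ofMono s))
    (G := sgn K i • (M i (D (ofMono s)) + sgn K (s.deg eilhDeg d) • M i (ofMono s) ∘ₗ D)
      + sgn K i • M (i + 1) (ofMono s)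
      - sgn K (s.deg eilhDeg d * q) • (M (i + 1)).flip (ofMono s))
    (fun n x h => hD _ _ (h.mul_right _ _))
    (fun n x h => ((((h.mul_right _ _).add (((hD _ _ h).mul_right _ _).smul _)).smul _).add
      ((h.mul_right _ _).smul _)).sub ((h.mul_left _ _).smul _)) ?_ hy
  rintro t rfl
  simp only [LinearMap.comp_apply, M, mulₗ_apply, mul_ofMono, D]
  rw [diff_ofMono hδ hδ']
  simp only [LinearMap.comp_apply, LinearMap.add_apply, LinearMap.sub_apply, LinearMap.smul_apply,
    LinearMap.flip_apply, mulₗ_apply, mul_ofMono, diff_ofMono hδ hδ', diffMono, leib]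

set_option linter.unusedSimpArgs false in
/-- A map that obeys the deformed Leibniz rule squares to zero if it does so on the generators. -/
theorem square_eq_zero_of_leib {Q : EilhHat K d →ₗ[K] EilhHat K d}
    (hd : ∀ p x, IsHomog eilhDeg d p x → IsHomog eilhDeg d (p + 1) (Q x))
    (ho : ∀ n x, OrderGE n x → OrderGE n (Q x))
    (hl : ∀ (i : ℕ) (p q : ℤ) (x y : EilhHat K d), IsHomog eilhDeg d p x →
      IsHomog eilhDeg d q y → Q (mul i x y) = leib i p q x (Q x) y (Q y))
    (h : ∀ a, Q (Q (ofMono (.gen a))) = 0) (x : EilhHat K d) : Q (Q x) = 0 := by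
  suffices Q ∘ₗ Q = 0 from LinearMap.congr_fun this x
  refine Formal.hom_ext (fun n x h => ho _ _ (ho _ _ h)) (fun n x _ => OrderGE.zero n) fun t => ?_
  change Q (Q (ofMono t)) = 0
  induction t with
  | gen a => exact h a
  | op i s t hs ht =>
    have h0 := ofMono_isHomog (R := {x | EilhRel K d x}) eilhDeg d s
    have h0' := ofMono_isHomog (R := {x | EilhRel K d x}) eilhDeg d t
    have h1 := hd _ _ h0
    have h1' := hd _ _ h0'
    rw [← mul_ofMono, hl i _ _ _ _ h0 h0', leib]
    simp only [map_add, map_sub, map_smul]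
    rw [hl i _ _ _ _ h1 h0', hl i _ _ _ _ h0 h1', hl (i + 1) _ _ _ _ h0 h0',
      hl (i + 1) _ _ _ _ h0' h0]
    simp only [leib, hs, ht, Formal.zero_mul, Formal.mul_zero]
    -- The terms containing a squared differential are gone. What is left cancels: the two mixed
    -- terms against each other, the terms with index `i + 1` and one differentiated factor in
    -- pairs, and those with index `i + 2` because `(-1)^(i+1) = -(-1)^i`.
    match_scalars
    all_goals
      simp only [Nat.cast_add, Nat.cast_one, Nat.cast_ofNat, mul_add, add_mul, sgn_add,
        sgn_one, mul_one, one_mul, mul_neg, neg_mul,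
        neg_neg, mul_assoc, mul_comm, mul_left_comm, sgn_mul_self, sgn_mul_sgn_mul]
    all_goals ring

end

end Differential

/-! ### The embedding turns the commutative product into the symmetrization of `⊘₀`. -/

section Shuffle

variable {K : Type*} [Field K] {A : Type*} {d : A → ℤ}

/-- The permutation that sends the last index to `j` and is given by `τ` on the others. -/
def lastPerm {n : ℕ} (j : Fin (n + 1)) (τ : Equiv.Perm (Fin n)) : Equiv.Perm (Fin (n + 1)) :=
  ((finSuccEquiv' (Fin.last n)).trans (Equiv.optionCongr τ)).trans (finSuccEquiv' j).symm

theorem lastPerm_castSucc {n : ℕ} (j : Fin (n + 1)) (τ : Equiv.Perm (Fin n)) (k : Fin n) :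
    lastPerm j τ k.castSucc = j.succAbove (τ k) := by
  have : finSuccEquiv' (Fin.last n) k.castSucc = some k := by
    rw [← Fin.succAbove_last, finSuccEquiv'_succAbove]
  simp [lastPerm, this]

theorem lastPerm_last {n : ℕ} (j : Fin (n + 1)) (τ : Equiv.Perm (Fin n)) :
    lastPerm j τ (Fin.last n) = j := by
  simp [lastPerm]

theorem lastPerm_bijective (n : ℕ) : Function.Bijective
    fun x : Fin (n + 1) × Equiv.Perm (Fin n) => lastPerm x.1 x.2 := by
  rw [Fintype.bijective_iff_injective_and_card]
  constructor
  · rintro ⟨j, τ⟩ ⟨j', τ'⟩ h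
    have h1 : ∀ k, lastPerm j τ k = lastPerm j' τ' k := fun k => Equiv.congr_fun h k
    obtain rfl : j = j' := by simpa [lastPerm_last] using h1 (Fin.last n)
    obtain rfl : τ = τ' := by
      ext k
      have := h1 k.castSucc
      rw [lastPerm_castSucc, lastPerm_castSucc] at this
      rw [Fin.succAbove_right_injective this]
    rfl
  · simp [Fintype.card_perm, Nat.factorial_succ]

/-- The Koszul sign of moving the letter `v j` to the end of the word `v`. -/
def lastSign (K : Type*) [Field K] (d : A → ℤ) {n : ℕ} (v : Fin (n + 1) → A) (j : Fin (n + 1)) :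
    K :=
  ∏ k : Fin n, if j < j.succAbove k then sgn K (d (v (j.succAbove k)) * d (v j)) else 1

/-- Inversions involving the last position give `lastSign`; those among the remaining positions are
the inversions of `τ`, since `j.succAbove` is increasing. -/
theorem koszul_lastPerm {n : ℕ} (v : Fin (n + 1) → A) (j : Fin (n + 1))
    (τ : Equiv.Perm (Fin n)) :
    koszul K d v (lastPerm j τ) = lastSign K d v j * koszul K d (v ∘ j.succAbove) τ := by
  have h : lastSign K d v j = ∏ k : Fin n, if j < j.succAbove (τ k) then
      sgn K (d (v (j.succAbove (τ k))) * d (v j)) else 1 :=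
    (Fintype.prod_equiv τ _ _ fun k => rfl).symm
  rw [koszul, koszul, Fintype.prod_prod_type, Fin.prod_univ_castSucc, Fintype.prod_prod_type, h]
  simp only [Fin.prod_univ_castSucc (n := n), lastPerm_castSucc, lastPerm_last,
    Fin.castSucc_lt_castSucc_iff, Fin.succAbove_lt_succAbove_iff, Fin.castSucc_lt_last,
    Finset.prod_mul_distrib, (Fin.castSucc_lt_last _).not_gt, lt_irrefl, false_and, true_and,
    if_false, Finset.prod_const_one, mul_one, Function.comp_apply]
  rw [mul_comm]

theorem nest_concat {l : List A} (hl : l ≠ []) (b : A) :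
    nest K d (l ++ [b]) = prod _ 0 (nest K d l) (cls _ (.gen b)) := by
  cases l with
  | nil => exact absurd rfl hl
  | cons a l => simp [nest, prod_cls]

/-- Permutations are grouped by their last letter, the only one that a left-nested product allows
one to peel off. -/
theorem symmetrize_succ {n : ℕ} (v : Fin (n + 2) → A) :
    symmetrize K d v = ∑ j, lastSign K d v j •
      prod _ 0 (symmetrize K d (v ∘ j.succAbove)) (cls _ (.gen (v j))) := by
  rw [symmetrize, ← (lastPerm_bijective (n + 1)).sum_comp fun σ => koszul K d v σ •
    nest K d (List.ofFn (v ∘ σ)), Fintype.sum_prod_type]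
  refine Finset.sum_congr rfl fun j _ => ?_
  rw [symmetrize, map_sum, LinearMap.sum_apply, Finset.smul_sum]
  refine Finset.sum_congr rfl fun τ _ => ?_
  rw [koszul_lastPerm, map_smul, LinearMap.smul_apply, smul_smul, ← nest_concat]
  · congr 2
    rw [List.ofFn_succ']
    simp [lastPerm_castSucc, lastPerm_last, Function.comp_def]
  · simp

theorem lastSign_cons_zero {n : ℕ} (a : A) (v : Fin (n + 1) → A) :
    lastSign K d (Fin.cons a v : Fin (n + 2) → A) 0 = sgn K (d a * ∑ k, d (v k)) := by
  have h : ∀ m (w : Fin m → A), ∏ k, sgn K (d (w k) * d a) = sgn K (d a * ∑ k, d (w k)) := by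
    intro m w
    induction m with
    | zero => simp [sgn_zero]
    | succ m ih =>
      have := ih (fun k => w k.succ)
      rw [Fin.prod_univ_succ, Fin.sum_univ_succ, mul_add, sgn_add, this, mul_comm (d (w 0))]
  simp [lastSign, ← h]

theorem lastSign_cons_succ {n : ℕ} (a : A) (v : Fin (n + 1) → A) (j : Fin (n + 1)) :
    lastSign K d (Fin.cons a v : Fin (n + 2) → A) j.succ = lastSign K d v j := by
  simp [lastSign, Fin.prod_univ_succ (n := n)]

theorem cons_comp_succAbove {n : ℕ} (a : A) (v : Fin (n + 1) → A) (j : Fin (n + 1)) :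
    (Fin.cons a v : Fin (n + 2) → A) ∘ j.succ.succAbove = Fin.cons a (v ∘ j.succAbove) := by
  funext k
  cases k using Fin.cases <;> simp

theorem nest_mem_homog (l : List A) :
    nest K d l ∈ homog {x | EilhRel K d x} eilhDeg d (wordDeg d l) := by
  cases l with
  | nil => exact Submodule.zero_mem _
  | cons a l =>
    have h : ∀ (l : List A) (t : Mono ℕ A),
        (l.foldl (fun t b => Mono.op 0 t (Mono.gen b)) t).deg eilhDeg d
          = t.deg eilhDeg d + wordDeg d l := by
      intro l
      induction l with
      | nil => intro t; simp [wordDeg]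
      | cons b l ih =>
        intro t
        rw [List.foldl_cons, ih]
        simp [Mono.deg, wordDeg, eilhDeg, add_assoc]
    refine Submodule.subset_span ⟨_, ?_, rfl⟩
    rw [h]
    simp [Mono.deg, wordDeg]

theorem symmetrize_mem_homog {n : ℕ} (v : Fin n → A) :
    symmetrize K d v ∈ homog {x | EilhRel K d x} eilhDeg d (∑ k, d (v k)) := by
  refine Submodule.sum_mem _ fun σ _ => Submodule.smul_mem _ _ ?_
  have h := nest_mem_homog (K := K) (d := d) (List.ofFn (v ∘ σ))
  have e : ∑ k, (d ∘ v ∘ σ) k = ∑ k, d (v k) := Equiv.sum_comp σ fun k => d (v k)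
  rwa [wordDeg, List.map_ofFn, List.sum_ofFn, e] at h

theorem symWord_mem_homog (l : List A) :
    symWord K d l ∈ homog {x | EilhRel K d x} eilhDeg d (wordDeg d l) := by
  have h := symmetrize_mem_homog (K := K) (d := d) l.get
  rwa [← List.sum_ofFn, show (fun k => d (l.get k)) = d ∘ l.get from rfl, ← List.map_ofFn,
    List.ofFn_get] at h

theorem Alg.hom_ext {I M : Type*} [AddCommGroup M] [Module K M] {R : Set (NonAssoc K I A)}
    {f g : Alg R →ₗ[K] M} (h : ∀ t, f (cls R t) = g (cls R t)) : f = g :=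
  Submodule.linearMap_qext _ (NonAssoc.hom_ext h)

/-- The relation `x ⊘₀ (y ⊘₀ z) = (x ⊘₀ y ± y ⊘₀ x) ⊘₀ z`. -/
theorem prod_zero_prod_zero {p q : ℤ} {x y : Eilh K d} (hx : x ∈ homog _ eilhDeg d p)
    (hy : y ∈ homog _ eilhDeg d q) (z : Eilh K d) :
    prod _ 0 x (prod _ 0 y z)
      = prod _ 0 (prod _ 0 x y) z + sgn K (p * q) • prod _ 0 (prod _ 0 y x) z := by
  induction hx using Submodule.span_induction with
  | zero => simp
  | add x x' _ _ h h' => simp only [map_add, LinearMap.add_apply, h, h']; module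
  | smul c x _ h => simp only [map_smul, LinearMap.smul_apply, h]; module
  | mem x hx =>
    obtain ⟨a, rfl, rfl⟩ := hx
    induction hy using Submodule.span_induction with
    | zero => simp
    | add x x' _ _ h h' => simp only [map_add, LinearMap.add_apply, h, h']; module
    | smul c x _ h => simp only [map_smul, LinearMap.smul_apply, h]; module
    | mem y hy =>
      obtain ⟨b, rfl, rfl⟩ := hy
      refine LinearMap.congr_fun (Alg.hom_ext (f := prod _ 0 (cls _ a) ∘ₗ prod _ 0 (cls _ b))
        (g := prod _ 0 (prod _ 0 (cls _ a) (cls _ b))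
          + sgn K (a.deg eilhDeg d * b.deg eilhDeg d) •
            prod _ 0 (prod _ 0 (cls _ b) (cls _ a))) fun c => ?_) z
      have h := (Submodule.Quotient.mk_eq_zero _).2
        (subset_ideal {x | EilhRel K d x} (EilhRel.eq 0 a b c))
      change (ideal {x | EilhRel K d x}).mkQ _ = 0 at h
      rw [map_sub, sub_eq_zero] at h
      simp only [LinearMap.comp_apply, LinearMap.add_apply, LinearMap.smul_apply, prod_cls]
      simpa [sgn_zero, cls] using h

theorem symmetrize_one (v : Fin 1 → A) : symmetrize K d v = cls _ (.gen (v 0)) := by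
  simp only [symmetrize, Finset.univ_unique, Finset.sum_singleton, koszul]
  rw [Finset.prod_eq_one fun x _ => if_neg fun h => ?_, one_smul]
  · simp [nest]
  · exact h.1.ne (Subsingleton.elim _ _)

/-- Induction through the last letter. If `a` itself comes last, the second summand appears;
otherwise the induction hypothesis inside the product and the Zinbiel identity assemble the first
summand. -/
theorem symmetrize_cons {n : ℕ} (a : A) (v : Fin (n + 1) → A) :
    symmetrize K d (Fin.cons a v : Fin (n + 2) → A) =
      prod _ 0 (cls _ (.gen a)) (symmetrize K d v)
      + sgn K (d a * ∑ k, d (v k)) • prod _ 0 (symmetrize K d v) (cls _ (.gen a)) := by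
  have ha : cls {x | EilhRel K d x} (.gen a) ∈ homog _ eilhDeg d (d a) :=
    Submodule.subset_span ⟨_, rfl, rfl⟩
  induction n with
  | zero =>
    rw [symmetrize_succ, Fin.sum_univ_succ, lastSign_cons_zero, add_comm]
    simp only [lastSign_cons_succ, cons_comp_succAbove, Fin.cons_succ]
    simp [symmetrize_one, lastSign, Function.comp_def]
  | succ n ih =>
    rw [symmetrize_succ, Fin.sum_univ_succ, lastSign_cons_zero, add_comm]
    congr 1
    rw [symmetrize_succ v, map_sum]
    refine Finset.sum_congr rfl fun j _ => ?_
    rw [lastSign_cons_succ, cons_comp_succAbove, Fin.cons_succ, map_smul,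
      prod_zero_prod_zero ha (symmetrize_mem_homog (v ∘ j.succAbove)), ih, map_add,
      LinearMap.add_apply, map_smul, LinearMap.smul_apply]

theorem symWord_singleton (a : A) : symWord K d [a] = cls _ (.gen a) := by
  exact symmetrize_one _

theorem symWord_cons (a : A) {l : List A} (hl : l ≠ []) :
    symWord K d (a :: l) = prod _ 0 (cls _ (.gen a)) (symWord K d l)
      + sgn K (d a * wordDeg d l) • prod _ 0 (symWord K d l) (cls _ (.gen a)) := by
  cases l with
  | nil => exact absurd rfl hl
  | cons b l =>
    have h := symmetrize_cons (K := K) (d := d) a (b :: l).get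
    have hget : (a :: b :: l).get = Fin.cons a (b :: l).get := by
      funext k
      cases k using Fin.cases <;> rfl
    have hdeg : ∑ k, d ((b :: l).get k) = wordDeg d (b :: l) := by
      rw [← List.sum_ofFn, show (fun k => d ((b :: l).get k)) = d ∘ (b :: l).get from rfl,
        ← List.map_ofFn, List.ofFn_get]
      rfl
    rw [← hdeg]
    exact (congrArg _ hget).trans h

/-- Adding a letter in front is symmetrized multiplication by it (`symWord_cons`), so the claim
amounts to associativity of the symmetrization of `⊘₀`, which the Zinbiel identity provides. -/
theorem symWord_append {u w : List A} (hu : u ≠ []) (hw : w ≠ []) :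
    symWord K d (u ++ w) = prod _ 0 (symWord K d u) (symWord K d w)
      + sgn K (wordDeg d u * wordDeg d w) • prod _ 0 (symWord K d w) (symWord K d u) := by
  induction u with
  | nil => exact absurd rfl hu
  | cons a u ih =>
    by_cases hu' : u = []
    · subst hu'
      rw [List.singleton_append, symWord_cons a hw, symWord_singleton]
      simp [wordDeg]
    · have ha : cls {x | EilhRel K d x} (.gen a) ∈ homog _ eilhDeg d (d a) :=
        Submodule.subset_span ⟨_, rfl, rfl⟩
      have h1 := symWord_mem_homog (K := K) (d := d) u
      have h2 := symWord_mem_homog (K := K) (d := d) w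
      have e1 : wordDeg d (a :: u) = d a + wordDeg d u := by simp [wordDeg]
      have e2 : wordDeg d (u ++ w) = wordDeg d u + wordDeg d w := by simp [wordDeg]
      rw [List.cons_append, symWord_cons a (by simp [hw]), symWord_cons a hu', ih hu', e1, e2]
      simp only [map_add, map_smul, LinearMap.add_apply, LinearMap.smul_apply]
      rw [prod_zero_prod_zero ha h1, prod_zero_prod_zero ha h2, prod_zero_prod_zero h2 ha,
        prod_zero_prod_zero h2 h1]
      match_scalars
      all_goals
        simp only [mul_add, sgn_add, mul_one, mul_assoc, mul_comm, mul_left_comm,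
          sgn_mul_self, sgn_mul_sgn_mul]

theorem emb_mem_homog {p : ℤ} {x : Sym K d} (hx : x ∈ homog _ symDeg d p) :
    emb K d x ∈ homog _ eilhDeg d p := by
  induction hx using Submodule.span_induction with
  | zero => simp
  | add x x' _ _ h h' => rw [map_add]; exact add_mem h h'
  | smul c x _ h => rw [map_smul]; exact Submodule.smul_mem _ c h
  | mem x hx =>
    obtain ⟨t, rfl, rfl⟩ := hx
    rw [emb_cls, ← wordDeg_word]
    exact symWord_mem_homog _

theorem Mono.word_ne_nil {I : Type*} (t : Mono I A) : t.word ≠ [] := by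
  cases t <;> simp [Mono.word]
  rename_i s t
  intro h
  exact absurd h (Mono.word_ne_nil s)

/-- The embedding sends the commutative product to the graded symmetrization of `⊘₀`. -/
theorem emb_prod {p q : ℤ} {x y : Sym K d} (hx : x ∈ homog _ symDeg d p)
    (hy : y ∈ homog _ symDeg d q) :
    emb K d (prod _ () x y) = prod _ 0 (emb K d x) (emb K d y)
      + sgn K (p * q) • prod _ 0 (emb K d y) (emb K d x) := by
  induction hx using Submodule.span_induction with
  | zero => simp
  | add x x' _ _ h h' => simp only [map_add, LinearMap.add_apply, h, h']; module
  | smul c x _ h => simp only [map_smul, LinearMap.smul_apply, h]; module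
  | mem x hx =>
    obtain ⟨s, rfl, rfl⟩ := hx
    induction hy using Submodule.span_induction with
    | zero => simp
    | add x x' _ _ h h' => simp only [map_add, LinearMap.add_apply, h, h']; module
    | smul c x _ h => simp only [map_smul, LinearMap.smul_apply, h]; module
    | mem y hy =>
      obtain ⟨t, rfl, rfl⟩ := hy
      rw [prod_cls, emb_cls, emb_cls, emb_cls, ← wordDeg_word, ← wordDeg_word]
      exact symWord_append s.word_ne_nil t.word_ne_nil

open Formal

theorem coeff_embHat (n : ℕ) (x : SymHat K d) : coeff n (embHat K d x) = emb K d (coeff n x) :=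
  rfl

theorem embHat_isHomog {p : ℤ} {x : SymHat K d} (hx : IsHomog symDeg d p x) :
    IsHomog eilhDeg d p (embHat K d x) := fun n => emb_mem_homog (hx n)

theorem embHat_orderGE {n : ℕ} {x : SymHat K d} (hx : OrderGE n x) :
    OrderGE n (embHat K d x) := fun m hm => by rw [coeff_embHat, hx m hm, map_zero]

theorem embHat_isFinite {x : SymHat K d} : IsFinite x → IsFinite (embHat K d x)
  | ⟨N, hN⟩ => ⟨N, fun n hn => by rw [coeff_embHat, hN n hn, map_zero]⟩

theorem embHat_mul {p q : ℤ} {x y : SymHat K d} (hx : IsHomog symDeg d p x)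
    (hy : IsHomog symDeg d q y) :
    embHat K d (mul () x y) = mul 0 (embHat K d x) (embHat K d y)
      + sgn K (p * q) • mul 0 (embHat K d y) (embHat K d x) := by
  ext n
  rw [coeff_embHat, coeff_mul, map_sum, Finset.sum_congr rfl fun k _ => emb_prod (hx k.1) (hy k.2),
    Finset.sum_add_distrib, ← Finset.smul_sum]
  rw [coeff_add, coeff_smul, coeff_mul, coeff_mul, ← Finset.Nat.sum_antidiagonal_swap
    (f := fun k => prod _ 0 (coeff k.1 (embHat K d y)) (coeff k.2 (embHat K d x)))]
  rfl

end Shuffle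

/-! ### The `EL_∞`-algebra of an `L_∞`-algebra: existence, uniqueness, finiteness. -/

section Lift

variable {K : Type*} [Field K] {A B : Type*} {d : A → ℤ} {d' : B → ℤ}

open Formal

theorem embHat_gen (a : A) : embHat K d (ofMono (.gen a)) = ofMono (.gen a) := by
  ext n
  rw [coeff_embHat, coeff_ofMono, coeff_ofMono, Mono.len, Mono.len]
  by_cases h : n = 1
  · rw [if_pos h, if_pos h, emb_cls]
    exact symWord_singleton a
  · rw [if_neg h, if_neg h, map_zero]

/-- A map that obeys the deformed Leibniz rule and extends `E ∘ Q` on the generators is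
intertwined with `Q` by `E`. -/
theorem diff_embHat (L : LInfty K d) {Q : EilhHat K d →ₗ[K] EilhHat K d}
    (ho : ∀ n x, OrderGE n x → OrderGE n (Q x))
    (hl : ∀ (i : ℕ) (p q : ℤ) (x y : EilhHat K d), IsHomog eilhDeg d p x →
      IsHomog eilhDeg d q y → Q (mul i x y) = leib i p q x (Q x) y (Q y))
    (h : ∀ a, Q (ofMono (.gen a)) = embHat K d (L.Q (ofMono (.gen a)))) (x : SymHat K d) :
    Q (embHat K d x) = embHat K d (L.Q x) := by
  suffices Q ∘ₗ embHat K d = embHat K d ∘ₗ L.Q from LinearMap.congr_fun this x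
  refine Formal.hom_ext (fun n x h => ho _ _ (embHat_orderGE h))
    (fun n x h => embHat_orderGE (L.order _ _ h)) fun t => ?_
  change Q (embHat K d (ofMono t)) = embHat K d (L.Q (ofMono t))
  induction t with
  | gen a => rw [embHat_gen, h]
  | op i s t hs ht =>
    have h0 := ofMono_isHomog (R := {x | SymRel K d x}) symDeg d s
    have h0' := ofMono_isHomog (R := {x | SymRel K d x}) symDeg d t
    have h1 := L.degree _ _ h0
    have h1' := L.degree _ _ h0'
    rw [← mul_ofMono, L.leibniz _ _ _ _ h0 h0', embHat_mul h0 h0', map_add, map_add, map_smul,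
      map_smul, hl 0 _ _ _ _ (embHat_isHomog h0) (embHat_isHomog h0'),
      hl 0 _ _ _ _ (embHat_isHomog h0') (embHat_isHomog h0), embHat_mul h1 h0',
      embHat_mul h0 h1', hs, ht, leib, leib]
    -- Each of `x ⊘₁ y` and `y ⊘₁ x` occurs twice, from the two summands of the symmetrized product,
    -- with opposite signs. Hence the deformation disappears on the image of `E` and the ordinary
    -- Leibniz rule remains.
    match_scalars
    all_goals
      simp only [sgn_zero, mul_add, add_mul, sgn_add, mul_one, one_mul, mul_neg,
        mul_comm, sgn_mul_self, sgn_mul_sgn_mul]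
    all_goals ring

/-- The `EL_∞`-algebra of an `L_∞`-algebra. -/
noncomputable def LInfty.toELInfty (L : LInfty K d) : ELInfty K d :=
  have hδ : ∀ a, IsHomog eilhDeg d (d a + 1) (embHat K d (L.Q (ofMono (.gen a)))) :=
    fun a => embHat_isHomog (L.degree _ _ (ofMono_isHomog symDeg d (.gen a)))
  have hδ' : ∀ a, OrderGE 1 (embHat K d (L.Q (ofMono (.gen a)))) :=
    fun a => embHat_orderGE (L.order _ _ (ofMono_orderGE (.gen a)))
  { Q := diff _ hδ
    degree := diff_isHomog hδ
    order := diff_orderGE hδ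
    leibniz := diff_leibniz hδ hδ'
    square := square_eq_zero_of_leib (diff_isHomog hδ) (diff_orderGE hδ) (diff_leibniz hδ hδ')
      fun a => by
        -- On a generator the square is the differential of `E(Qv)`, which is `E(Q(Qv)) = 0`.
        rw [diff_ofMono hδ hδ', diffMono, diff_embHat L (diff_orderGE hδ) (diff_leibniz hδ hδ')
          fun a => diff_ofMono hδ hδ' (.gen a), L.square, map_zero] }

theorem LInfty.toELInfty_gen (L : LInfty K d) (a : A) :
    L.toELInfty.Q (ofMono (.gen a)) = embHat K d (L.Q (ofMono (.gen a))) :=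
  diff_ofMono (fun a => embHat_isHomog (L.degree _ _ (ofMono_isHomog symDeg d (.gen a))))
    (fun a => embHat_orderGE (L.order _ _ (ofMono_orderGE (.gen a)))) (.gen a)

theorem forall_incl_iff {F : EilhHat K d' →ₗ[K] EilhHat K d} {G : SymHat K d' →ₗ[K] EilhHat K d} :
    (∀ v : B →₀ K, F (incl _ v) = G (incl _ v)) ↔
      ∀ b, F (ofMono (.gen b)) = G (ofMono (.gen b)) := by
  constructor
  · intro h b
    have := h (Finsupp.single b 1)
    rwa [incl_single, incl_single] at this
  · intro h v
    refine LinearMap.congr_fun (f := F ∘ₗ incl _) (g := G ∘ₗ incl _)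
      (Finsupp.lhom_ext' fun b => LinearMap.ext_ring ?_) v
    change F (incl _ (Finsupp.single b 1)) = G (incl _ (Finsupp.single b 1))
    rw [incl_single, incl_single, h b]

theorem LInfty.isRegardedAs_iff (L : LInfty K d) (Lh : ELInfty K d) : L.IsRegardedAs Lh ↔
    ∀ a, Lh.Q (ofMono (.gen a)) = embHat K d (L.Q (ofMono (.gen a))) :=
  forall_incl_iff (G := embHat K d ∘ₗ L.Q)

/-- The deformed Leibniz rule propagates equality from generators to monomials, and the filtration
condition carries it on to formal sums. -/
theorem ELInfty.ext_gen {E F : ELInfty K d}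
    (h : ∀ a, E.Q (ofMono (.gen a)) = F.Q (ofMono (.gen a))) : E = F := by
  have hQ : E.Q = F.Q := by
    refine Formal.hom_ext E.order F.order fun t => ?_
    induction t with
    | gen a => exact h a
    | op i s t hs ht =>
      have h0 := ofMono_isHomog (R := {x | EilhRel K d x}) eilhDeg d s
      have h0' := ofMono_isHomog (R := {x | EilhRel K d x}) eilhDeg d t
      rw [← mul_ofMono, E.leibniz i _ _ _ _ h0 h0', F.leibniz i _ _ _ _ h0 h0', hs, ht]
  cases E
  cases F
  cases hQ
  rfl

theorem LInfty.existsUnique_isRegardedAs (L : LInfty K d) :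
    ∃! Lh : ELInfty K d, L.IsRegardedAs Lh := by
  refine ⟨L.toELInfty, (L.isRegardedAs_iff _).2 L.toELInfty_gen, fun E hE => ?_⟩
  exact ELInfty.ext_gen fun a => by rw [(L.isRegardedAs_iff E).1 hE, L.toELInfty_gen]

/-- A linear map on formal sums sends finite sums to finite sums if it does so for the
monomials. -/
theorem isFinite_of_ofMono {I J : Type*} {R : Set (NonAssoc K I A)} {R' : Set (NonAssoc K J B)}
    [OrderHomogeneous R] {F : Formal R →ₗ[K] Formal R'} (h : ∀ t, IsFinite (F (ofMono t)))
    {x : Formal R} (hx : IsFinite x) : IsFinite (F x) := by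
  replace hx := hx.mem_span
  induction hx using Submodule.span_induction with
  | zero => rw [map_zero]; exact IsFinite.zero
  | add x y _ _ hx hy => rw [map_add]; exact hx.add hy
  | smul c x _ hx => rw [map_smul]; exact hx.smul c
  | mem x hx =>
    obtain ⟨t, rfl⟩ := hx
    exact h t

theorem ELInfty.isFinite {E : ELInfty K d} (h : ∀ a, IsFinite (E.Q (ofMono (.gen a))))
    {x : EilhHat K d} (hx : IsFinite x) : IsFinite (E.Q x) := by
  refine isFinite_of_ofMono (fun t => ?_) hx
  induction t with
  | gen a => exact h a
  | op i s t hs ht =>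
    have h0 := ofMono_isHomog (R := {x | EilhRel K d x}) eilhDeg d s
    have h0' := ofMono_isHomog (R := {x | EilhRel K d x}) eilhDeg d t
    have f0 := ofMono_isFinite (R := {x | EilhRel K d x}) s
    have f0' := ofMono_isFinite (R := {x | EilhRel K d x}) t
    rw [← mul_ofMono, E.leibniz i _ _ _ _ h0 h0']
    exact ((((hs.mul i f0').add ((f0.mul i ht).smul _)).smul _).add
      ((f0.mul (i + 1) f0').smul _)).sub ((f0'.mul (i + 1) f0).smul _)

/-! ### Lifts of morphisms -/

/-- The value on a monomial of the map that preserves the products and is given by `f` on the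
generators. -/
noncomputable def homMono (f : B → EilhHat K d) : Mono ℕ B → EilhHat K d
  | .gen b => f b
  | .op i s t => mul i (homMono f s) (homMono f t)

theorem homMono_isHomog {f : B → EilhHat K d} (hf : ∀ b, IsHomog eilhDeg d (d' b) (f b))
    (t : Mono ℕ B) : IsHomog eilhDeg d (t.deg eilhDeg d') (homMono f t) := by
  induction t with
  | gen b => exact hf b
  | op i s t hs ht => exact hs.mul i ht

theorem homMono_orderGE {f : B → EilhHat K d} (hf : ∀ b, OrderGE 1 (f b))
    (t : Mono ℕ B) : OrderGE t.len (homMono f t) := by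
  induction t with
  | gen b => exact hf b
  | op i s t hs ht => exact hs.mul i ht

-- The relations hold for all homogeneous formal sums in the target, and a degree-preserving `f`
-- leaves the signs in them unchanged.
set_option linter.unusedSimpArgs false in
theorem ideal_le_ker_homMono {f : B → EilhHat K d}
    (hf : ∀ b, IsHomog eilhDeg d (d' b) (f b)) :
    ideal {x | EilhRel K d' x} ≤ LinearMap.ker (onMono (homMono f)) := by
  have hmul : ∀ (i : ℕ) (x y : NonAssoc K ℕ B), onMono (homMono f) (NonAssoc.mul i x y)
      = mul i (onMono (homMono f) x) (onMono (homMono f) y) := by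
    intro i x y
    have h : (NonAssoc.mul i).compr₂ (onMono (homMono f))
        = (mulₗ _ i).compl₁₂ (onMono (homMono f)) (onMono (homMono f)) := by
      refine NonAssoc.hom_ext fun s => NonAssoc.hom_ext fun t => ?_
      simp [NonAssoc.mul_mono, homMono]
    exact LinearMap.congr_fun₂ h x y
  refine ideal_le ?_ ?_
  · intro x hx
    have h0 := homMono_isHomog hf
    rw [SetLike.mem_coe, LinearMap.mem_ker]
    rcases hx with ⟨i, a, b, c⟩ | ⟨i, j, h, a, b, c⟩ | ⟨i, j, h, a, b, c⟩ | ⟨i, j, h, a, b, c⟩ |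
      ⟨i, j, h, a, b, c⟩
    · simp only [map_add, map_sub, map_smul, onMono_mono, homMono]
      rw [mul_mul_eq i (h0 a) (h0 b) (h0 c), smul_add, smul_smul, sub_self]
    · simp only [map_add, map_sub, map_smul, onMono_mono, homMono]
      rw [mul_mul_lt h (h0 a) (h0 b) (h0 c), sub_self]
    · subst h
      simp only [map_add, map_sub, map_smul, onMono_mono, homMono]
      rw [mul_mul_add_one i (h0 a) (h0 b) (h0 c), sub_self]
    · subst h
      simp only [map_add, map_sub, map_smul, onMono_mono, homMono, Nat.cast_add, Nat.cast_ofNat,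
        Nat.reduceSubDiff]
      rw [mul_mul_add_two i (h0 a) (h0 b) (h0 c), sub_self]
    · obtain ⟨j, rfl⟩ : ∃ k, j = k + 1 := ⟨j - 1, by omega⟩
      simp only [map_add, map_sub, map_smul, onMono_mono, homMono, Nat.cast_add, Nat.cast_one,
        Nat.add_one_sub_one]
      rw [mul_mul_gt (by omega : i + 1 < j) (h0 a) (h0 b) (h0 c), sub_self]
  · intro i x y h
    simp only [LinearMap.mem_ker, hmul] at h ⊢
    rcases h with h | h <;> simp [h]

/-- The morphism of `Eilh`-algebras given by `f` on the generators. -/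
noncomputable def eilhHom (f : B → EilhHat K d) (hf : ∀ b, IsHomog eilhDeg d (d' b) (f b)) :
    EilhHat K d' →ₗ[K] EilhHat K d :=
  extend ((ideal {x | EilhRel K d' x}).liftQ (onMono (homMono f)) (ideal_le_ker_homMono hf))

section

variable {f : B → EilhHat K d} (hf : ∀ b, IsHomog eilhDeg d (d' b) (f b))

theorem liftQ_homMono_cls (t : Mono ℕ B) :
    (ideal {x | EilhRel K d' x}).liftQ (onMono (homMono f)) (ideal_le_ker_homMono hf)
      (cls _ t) = homMono f t :=
  onMono_mono _ t

theorem eilhHom_isHomog (p : ℤ) (x : EilhHat K d') (hx : IsHomog eilhDeg d' p x) :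
    IsHomog eilhDeg d p (eilhHom f hf x) := by
  have := extend_isHomog (F := (ideal {x | EilhRel K d' x}).liftQ (onMono (homMono f))
    (ideal_le_ker_homMono hf)) (k := 0) (ω' := eilhDeg) (d' := d) (ω := eilhDeg) (d := d')
    (fun t => by rw [liftQ_homMono_cls hf, add_zero]; exact homMono_isHomog hf t) p x hx
  rwa [add_zero] at this

theorem eilhHom_orderGE (n : ℕ) (x : EilhHat K d') (hx : OrderGE n x) :
    OrderGE n (eilhHom f hf x) := extend_orderGE _ n x hx

theorem eilhHom_ofMono (hf' : ∀ b, OrderGE 1 (f b)) (t : Mono ℕ B) :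
    eilhHom f hf (ofMono t) = homMono f t := by
  rw [eilhHom, extend_ofMono fun t => ?_, liftQ_homMono_cls hf]
  rw [liftQ_homMono_cls hf]
  exact homMono_orderGE hf' t

theorem eilhHom_mul (hf' : ∀ b, OrderGE 1 (f b)) (i : ℕ) (x y : EilhHat K d') :
    eilhHom f hf (mul i x y) = mul i (eilhHom f hf x) (eilhHom f hf y) := by
  set Φ := eilhHom f hf
  have hΦ := eilhHom_orderGE hf
  refine LinearMap.congr_fun (f := Φ ∘ₗ (mulₗ _ i).flip y) (g := (mulₗ _ i).flip (Φ y) ∘ₗ Φ)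
    (Formal.hom_ext (fun n x h => hΦ _ _ (h.mul_left _ _))
      (fun n x h => (hΦ _ _ h).mul_left _ _) fun s => ?_) x
  refine LinearMap.congr_fun (f := Φ ∘ₗ mulₗ _ i (ofMono s)) (g := mulₗ _ i (Φ (ofMono s)) ∘ₗ Φ)
    (Formal.hom_ext (fun n x h => hΦ _ _ (h.mul_right _ _))
      (fun n x h => (hΦ _ _ h).mul_right _ _) fun t => ?_) y
  simp only [LinearMap.comp_apply, mulₗ_apply, mul_ofMono, Φ, eilhHom_ofMono hf hf', homMono]

end

/-- A map that preserves the products and extends `E ∘ Φ` on the generators is intertwined with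
`Φ` by `E`. -/
theorem hom_embHat {L : LInfty K d} {L' : LInfty K d'} (φ : LInfty.Hom L L')
    {Ψ : EilhHat K d' →ₗ[K] EilhHat K d} (ho : ∀ n x, OrderGE n x → OrderGE n (Ψ x))
    (hm : ∀ (i : ℕ) x y, Ψ (mul i x y) = mul i (Ψ x) (Ψ y))
    (h : ∀ b, Ψ (ofMono (.gen b)) = embHat K d (φ.Φ (ofMono (.gen b)))) (x : SymHat K d') :
    Ψ (embHat K d' x) = embHat K d (φ.Φ x) := by
  suffices Ψ ∘ₗ embHat K d' = embHat K d ∘ₗ φ.Φ from LinearMap.congr_fun this x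
  refine Formal.hom_ext (fun n x h => ho _ _ (embHat_orderGE h))
    (fun n x h => embHat_orderGE (φ.order _ _ h)) fun t => ?_
  change Ψ (embHat K d' (ofMono t)) = embHat K d (φ.Φ (ofMono t))
  induction t with
  | gen a => rw [embHat_gen, h]
  | op i s t hs ht =>
    have h0 := ofMono_isHomog (R := {x | SymRel K d' x}) symDeg d' s
    have h0' := ofMono_isHomog (R := {x | SymRel K d' x}) symDeg d' t
    rw [← mul_ofMono, φ.mul, embHat_mul h0 h0', embHat_mul (φ.degree _ _ h0) (φ.degree _ _ h0'),
      map_add, map_smul, hm, hm, hs, ht]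

/-- The lift of a morphism of `L_∞`-algebras. -/
noncomputable def LInfty.Hom.lift {L : LInfty K d} {L' : LInfty K d'} (φ : LInfty.Hom L L')
    {Lh : ELInfty K d} {Lh' : ELInfty K d'} (h : L.IsRegardedAs Lh) (h' : L'.IsRegardedAs Lh') :
    ELInfty.Hom Lh Lh' :=
  have hf : ∀ b, IsHomog eilhDeg d (d' b) (embHat K d (φ.Φ (ofMono (.gen b)))) :=
    fun b => embHat_isHomog (φ.degree _ _ (ofMono_isHomog symDeg d' (.gen b)))
  have hf' : ∀ b, OrderGE 1 (embHat K d (φ.Φ (ofMono (.gen b)))) :=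
    fun b => embHat_orderGE (φ.order _ _ (ofMono_orderGE (.gen b)))
  { Φ := eilhHom _ hf
    degree := eilhHom_isHomog hf
    order := eilhHom_orderGE hf
    mul := eilhHom_mul hf hf'
    comm := by
      rw [LInfty.isRegardedAs_iff] at h h'
      have hΦ := eilhHom_orderGE hf
      intro x
      suffices Lh.Q ∘ₗ eilhHom _ hf = eilhHom _ hf ∘ₗ Lh'.Q from LinearMap.congr_fun this x
      refine Formal.hom_ext (fun n x h => Lh.order _ _ (hΦ _ _ h))
        (fun n x h => hΦ _ _ (Lh'.order _ _ h)) fun t => ?_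
      simp only [LinearMap.comp_apply]
      induction t with
      | gen b =>
        -- With hats for the lifted maps and primes for the differentials of `L'` and `Lh'`, on a
        -- generator: `Q̂Φ̂b = Q̂EΦb = EQΦb = EΦQ'b = Φ̂EQ'b = Φ̂Q̂'b`.
        rw [eilhHom_ofMono hf hf', homMono, h', diff_embHat L Lh.order Lh.leibniz h, φ.comm,
          hom_embHat φ hΦ (eilhHom_mul hf hf') fun b => eilhHom_ofMono hf hf' (.gen b)]
      | op i s t hs ht =>
        have h0 := ofMono_isHomog (R := {x | EilhRel K d' x}) eilhDeg d' s
        have h0' := ofMono_isHomog (R := {x | EilhRel K d' x}) eilhDeg d' t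
        rw [← mul_ofMono, eilhHom_mul hf hf', Lh'.leibniz i _ _ _ _ h0 h0',
          Lh.leibniz i _ _ _ _ (eilhHom_isHomog hf _ _ h0) (eilhHom_isHomog hf _ _ h0'), hs, ht]
        -- The morphism preserves degrees, so the signs in the two Leibniz rules agree term by term.
        simp only [map_add, map_sub, map_smul, eilhHom_mul hf hf'] }

theorem LInfty.Hom.lift_gen {L : LInfty K d} {L' : LInfty K d'} (φ : LInfty.Hom L L')
    {Lh : ELInfty K d} {Lh' : ELInfty K d'} (h : L.IsRegardedAs Lh) (h' : L'.IsRegardedAs Lh')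
    (b : B) : (φ.lift h h').Φ (ofMono (.gen b)) = embHat K d (φ.Φ (ofMono (.gen b))) :=
  eilhHom_ofMono (fun b => embHat_isHomog (φ.degree _ _ (ofMono_isHomog symDeg d' (.gen b))))
    (fun b => embHat_orderGE (φ.order _ _ (ofMono_orderGE (.gen b)))) (.gen b)

theorem ELInfty.Hom.ext_gen {E : ELInfty K d} {E' : ELInfty K d'} {φ ψ : ELInfty.Hom E E'}
    (h : ∀ b, φ.Φ (ofMono (.gen b)) = ψ.Φ (ofMono (.gen b))) : φ = ψ := by
  have hΦ : φ.Φ = ψ.Φ := by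
    refine Formal.hom_ext φ.order ψ.order fun t => ?_
    induction t with
    | gen b => exact h b
    | op i s t hs ht => rw [← mul_ofMono, φ.mul, ψ.mul, hs, ht]
  cases φ
  cases ψ
  cases hΦ
  rfl

theorem ELInfty.Hom.isFinite {E : ELInfty K d} {E' : ELInfty K d'} (φ : ELInfty.Hom E E')
    (h : ∀ b, IsFinite (φ.Φ (ofMono (.gen b)))) {x : EilhHat K d'} (hx : IsFinite x) :
    IsFinite (φ.Φ x) := by
  refine isFinite_of_ofMono (fun t => ?_) hx
  induction t with
  | gen a => exact h a
  | op i s t hs ht => rw [← mul_ofMono, φ.mul]; exact hs.mul i ht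

theorem isFinite_of_isRegardedAs {L : LInfty K d} {Lh : ELInfty K d} (h : L.IsRegardedAs Lh)
    (hL : ∀ v, (L.Q (Formal.incl _ v)).IsFinite) (x : EilhHat K d) (hx : x.IsFinite) :
    (Lh.Q x).IsFinite := by
  refine ELInfty.isFinite (fun a => ?_) hx
  rw [(L.isRegardedAs_iff Lh).1 h, ← incl_single]
  exact embHat_isFinite (hL _)

end Lift

end ELInfinity

/-! ### Assembly of the theorem. -/

open ELInfinity in
theorem mainTheorem8 {K : Type*} [Field K] [CharZero K] {A B : Type*} {d : A → ℤ} {d' : B → ℤ}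
    (L : LInfty K d) (L' : LInfty K d') (φ : LInfty.Hom L L') :
    (∃! Lh : ELInfty K d, L.IsRegardedAs Lh) ∧
    (∃! Lh' : ELInfty K d', L'.IsRegardedAs Lh') ∧
    ∀ (Lh : ELInfty K d) (Lh' : ELInfty K d'), L.IsRegardedAs Lh → L'.IsRegardedAs Lh' →
      ((∀ v, (L.Q (Formal.incl _ v)).IsFinite) → ∀ x, x.IsFinite → (Lh.Q x).IsFinite) ∧
      ((∀ v, (L'.Q (Formal.incl _ v)).IsFinite) → ∀ x, x.IsFinite → (Lh'.Q x).IsFinite) ∧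
      ∃ φh : ELInfty.Hom Lh Lh',
        (∀ v : B →₀ K, φh.Φ (Formal.incl _ v) = embHat K d (φ.Φ (Formal.incl _ v))) ∧
        (∀ ψ : ELInfty.Hom Lh Lh',
          (∀ v : B →₀ K, ψ.Φ (Formal.incl _ v) = embHat K d (φ.Φ (Formal.incl _ v))) →
            ψ = φh) ∧
        (∀ x, φh.Φ (embHat K d' x) = embHat K d (φ.Φ x)) ∧
        ((∀ v, (φ.Φ (Formal.incl _ v)).IsFinite) → ∀ x, x.IsFinite → (φh.Φ x).IsFinite) := by
  refine ⟨L.existsUnique_isRegardedAs, L'.existsUnique_isRegardedAs, fun Lh Lh' h h' =>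
    ⟨isFinite_of_isRegardedAs h, isFinite_of_isRegardedAs h', φ.lift h h', ?_, ?_, ?_, ?_⟩⟩
  · exact forall_incl_iff (G := embHat K d ∘ₗ φ.Φ).2 (φ.lift_gen h h')
  · intro ψ hψ
    have := forall_incl_iff (G := embHat K d ∘ₗ φ.Φ).1 hψ
    exact ELInfty.Hom.ext_gen fun b => (this b).trans (φ.lift_gen h h' b).symm
  · exact hom_embHat φ (φ.lift h h').order (φ.lift h h').mul (φ.lift_gen h h')
  · intro hφ x hx
    refine (φ.lift h h').isFinite (fun b => ?_) hx
    rw [φ.lift_gen h h', ← Formal.incl_single]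
    exact embHat_isFinite (hφ _)
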